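/- Let $0<L\le H$ and let $\Omega=(0,L)\times(0,H)\subset\mathbb R^2=\mathbb C$. For boundary points $p\ne q$ of $\Omega$, the renormalized energy is $$W_\Omega(p,q)=\frac{2}{\pi}\log\frac{|\varphi(p)-\varphi(q)|^2}{|\varphi'(p)|\,|\varphi'(q)|},$$ where $\varphi$ is a conformal map of $\Omega$ onto the upper half-plane $\{x+iy: y>0\}$ such that $\varphi$ and $\varphi'$ have finite limits $\varphi(p),\varphi(q)$ and $\varphi'(p),\varphi'(q)$ at $p$ and $q$, with $\varphi'(p),\varphi'(q)\neq 0$; the value does not depend on the choice of $\varphi$, and such a $\varphi$ exists whenever neither $p$ nor $q$ is a corner of $\Omega$ (the value assigned at corners is irrelevant below). Then $W_\Omega$, as a function on $(\partial\Omega\times\partial\Omega)\setminus\{(p,p):p\in\partial\Omega\}$, has an isolated local minimum at $(p,q)=\big((L/2,0),(L/2,H)\big)$: there is a neighbourhood of this pair in $\partial\Omega\times\partial\Omega$ in which $W_\Omega$ takes a strictly larger value at every other pair, and in which no other pair is a local minimizer of $W_\Omega$. -/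

import Mathlib

open Set Filter Topology
open scoped Complex

/-- The open rectangle `(0,L) × (0,H)`, in the plane `ℝ² = ℂ`. -/
def openRectangle (L H : ℝ) : Set ℂ := Ioo 0 L ×ℂ Ioo 0 H

/-- `φ` maps `Ω` conformally (holomorphically and bijectively) onto the open upper half-plane. -/
structure IsConformalOntoHalfPlane (Ω : Set ℂ) (φ : ℂ → ℂ) : Prop where
  differentiableOn : DifferentiableOn ℂ φ Ω
  bijOn : BijOn φ Ω {z : ℂ | 0 < z.im}

/-- `φ` extends from `Ω` to the point `p` (of the boundary of `Ω`) as a `C¹` map with finite value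
`φ(p) = a` and nonzero complex derivative `φ'(p) = a'`: the values and the derivatives of `φ`
tend to `a` and to `a' ≠ 0` when `p` is approached from within `Ω`. -/
structure HasRegularBoundaryValue (Ω : Set ℂ) (φ : ℂ → ℂ) (p a a' : ℂ) : Prop where
  tendsto_value : Tendsto φ (𝓝[Ω] p) (𝓝 a)
  tendsto_deriv : Tendsto (deriv φ) (𝓝[Ω] p) (𝓝 a')
  deriv_ne_zero : a' ≠ 0

/-- `w = (2/π) log (|φ(p) - φ(q)|² / (|φ'(p)| |φ'(q)|))` for some conformal map `φ` of `Ω` onto the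
upper half-plane that is regular at the boundary points `p` and `q` (so neither of them is sent
to infinity). -/
def IsRenormalizedEnergyValue (Ω : Set ℂ) (p q : ℂ) (w : ℝ) : Prop :=
  ∃ (φ : ℂ → ℂ) (a b a' b' : ℂ),
    IsConformalOntoHalfPlane Ω φ ∧
    HasRegularBoundaryValue Ω φ p a a' ∧
    HasRegularBoundaryValue Ω φ q b b' ∧
    w = 2 / Real.pi * Real.log (‖a - b‖ ^ 2 / (‖a'‖ * ‖b'‖))

open Classical in
/-- The renormalized energy `W_Ω(p,q)` for distinct boundary points `p`, `q`. The value does not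
depend on the conformal map chosen, since two such maps differ by a real Möbius transformation.
Where no conformal map is regular at both points (at a corner of a polygon, say) the function is
given the conventional value `0`. -/
noncomputable def renormalizedEnergy (Ω : Set ℂ) (p q : ℂ) : ℝ :=
  if h : ∃ w : ℝ, IsRenormalizedEnergyValue Ω p q w then h.choose else 0

/-- The set `(∂Ω × ∂Ω) \ {(p,p) : p ∈ ∂Ω}` on which the renormalized energy is considered. -/
def distinctBoundaryPairs (Ω : Set ℂ) : Set (ℂ × ℂ) :=
  {z | z.1 ∈ frontier Ω ∧ z.2 ∈ frontier Ω ∧ z.1 ≠ z.2}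

/-- The point `a` of `S` is an isolated local minimizer of `f` on `S` (with the subspace topology):
`f` has a strict local minimum at `a`, and no other point of `S` close to `a` is a local minimizer
of `f` on `S`. -/
structure IsIsolatedLocalMinOn {X : Type*} [TopologicalSpace X] (f : X → ℝ) (S : Set X) (a : X) :
    Prop where
  mem : a ∈ S
  isLocalMinOn : IsLocalMinOn f S a
  strict : ∀ᶠ x in 𝓝[S \ {a}] a, f a < f x
  isolated : ∀ᶠ x in 𝓝[S \ {a}] a, ¬ IsLocalMinOn f S x

/-! Let `℘` be the Weierstrass function with periods `2L` and `2iH`. Up to sign it maps the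
rectangle conformally onto the upper half-plane, the corner `0` going to infinity, so the energy can
be computed from `℘`. The identity `℘'(z) ℘'(w) = (℘(z) - ℘(w))² (℘(z - w) - ℘(z + w))`
(`PeriodPair.derivWeierstrassP_mul`) collapses the quotient: for `p = x` and `q = y + iH` the energy
is `-(2/π) log |Q(y - x) - Q(x + y)|` with `Q(u) = ℘(u + iH)`.

`Q` is real, even, symmetric about `L` and strictly monotone on `[0, L]`. With `d = y - x` and `e =
x + y - L` the difference is, up to sign, `Q(L - |e|) - Q(|d|)`. Near `d = e = 0` its modulus grows
strictly as `|d|` and `|e|` are scaled down together. Hence the energy decreases strictly along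
every segment towards the pair of midpoints. This gives both the strict minimum and the absence of
other local minimizers nearby.

Two general facts support the computation. The energy may be evaluated with any conformal map, since
two such maps differ by a Möbius transformation (Schwarz lemma). The identity holds because the
difference of its sides is an odd elliptic function without poles, hence zero (Liouville); it also
yields the zeros of `℘'` and the injectivity of `℘` on the rectangle. -/

/-! ### Injective holomorphic maps; uniqueness of the conformal map up to Möbius transformations. -/

/-- If the derivative vanished, then `f - f z₀ = c kⁿ` near `z₀` with `n ≥ 2` and `k` a local
coordinate. The points where `k` equals `u` and `ζ u`, with `ζ` a primitive `n`-th root of unity,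
would have the same image. -/
theorem AnalyticAt.deriv_ne_zero_of_injOn {f : ℂ → ℂ} {z₀ : ℂ} {U : Set ℂ}
    (hf : AnalyticAt ℂ f z₀) (hU : U ∈ 𝓝 z₀) (hinj : InjOn f U) : deriv f z₀ ≠ 0 := by
  intro h0
  have hz₀ : z₀ ∈ U := mem_of_mem_nhds hU
  have hg : AnalyticAt ℂ (fun z => f z - f z₀) z₀ := by fun_prop
  have hne : ¬ ∀ᶠ z in 𝓝 z₀, f z - f z₀ = 0 := by
    intro h
    have h1 : ∀ᶠ z in 𝓝[≠] z₀, z = z₀ := by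
      filter_upwards [nhdsWithin_le_nhds h, nhdsWithin_le_nhds hU] with z hz hzU
      exact hinj hzU hz₀ (sub_eq_zero.1 hz)
    obtain ⟨z, hz, hz'⟩ := (h1.and self_mem_nhdsWithin).exists
    exact hz' hz
  obtain ⟨n, h, hh, hh0, hfh⟩ := hg.exists_eventuallyEq_pow_smul_nonzero_iff.2 hne
  have hn0 : n ≠ 0 := by
    rintro rfl
    have := hfh.self_of_nhds
    simp at this
    exact hh0 this.symm
  have hn1 : n ≠ 1 := by
    rintro rfl
    have h1 : HasDerivAt (fun z => (z - z₀) ^ 1 • h z) (h z₀) z₀ := by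
      have := ((hasDerivAt_id z₀).sub_const z₀).mul hh.differentiableAt.hasDerivAt
      simpa [Pi.mul_def] using this
    have h2 : HasDerivAt (fun z => f z - f z₀) (h z₀) z₀ := h1.congr_of_eventuallyEq hfh
    have h3 := h2.deriv
    rw [deriv_sub_const, h0] at h3
    exact hh0 h3.symm
  have hn : 2 ≤ n := by omega
  have hnC : (n : ℂ) ≠ 0 := by exact_mod_cast hn0
  set k : ℂ → ℂ := fun z => (z - z₀) * Complex.exp (Complex.log (h z / h z₀) / n) with hk
  have hdiv : AnalyticAt ℂ (fun z => h z / h z₀) z₀ := by fun_prop (disch := exact hh0)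
  have hlog : AnalyticAt ℂ (fun z => Complex.log (h z / h z₀)) z₀ :=
    hdiv.clog (by simp [hh0])
  have hE : AnalyticAt ℂ (fun z => Complex.exp (Complex.log (h z / h z₀) / n)) z₀ := by
    fun_prop (disch := exact hnC)
  have hkA : AnalyticAt ℂ k z₀ := by fun_prop
  have hkd : HasDerivAt k 1 z₀ := by
    have := ((hasDerivAt_id z₀).sub_const z₀).mul hE.differentiableAt.hasDerivAt
    simpa [hk, Pi.mul_def, hh0] using this
  have hks : HasStrictDerivAt k 1 z₀ := by
    have := hkA.hasStrictDerivAt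
    rwa [hkd.deriv] at this
  have hmap : map k (𝓝 z₀) = 𝓝 0 := by
    have := hks.map_nhds_eq one_ne_zero
    rwa [show k z₀ = 0 by simp [hk]] at this
  have hhne : ∀ᶠ z in 𝓝 z₀, h z ≠ 0 := hh.continuousAt.eventually_ne hh0
  have hgood : ∀ᶠ z in 𝓝 z₀, z ∈ U ∧ f z - f z₀ = h z₀ * k z ^ n := by
    filter_upwards [hU, hfh, hhne] with z hz1 hz2 hz3
    refine ⟨hz1, ?_⟩
    rw [hz2, hk]
    simp only [smul_eq_mul, mul_pow]
    rw [← Complex.exp_nat_mul, mul_div_cancel₀ _ hnC, Complex.exp_log (div_ne_zero hz3 hh0)]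
    field_simp
  have himg : k '' {z | z ∈ U ∧ f z - f z₀ = h z₀ * k z ^ n} ∈ 𝓝 (0 : ℂ) := by
    rw [← hmap]; exact image_mem_map hgood
  have hζ := Complex.isPrimitiveRoot_exp n hn0
  set ζ := Complex.exp (2 * Real.pi * Complex.I / n)
  have hT : Tendsto (fun u : ℂ => ζ * u) (𝓝 0) (𝓝 0) := by
    have : Continuous (fun u : ℂ => ζ * u) := by fun_prop
    simpa using this.tendsto 0
  have himg' : ∀ᶠ u in 𝓝 (0 : ℂ), u ∈ k '' {z | z ∈ U ∧ f z - f z₀ = h z₀ * k z ^ n} := himg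
  obtain ⟨u, ⟨⟨z₁, ⟨hz1, hz1'⟩, hu1⟩, ⟨z₂, ⟨hz2, hz2'⟩, hu2⟩⟩, hu0⟩ :=
    (((himg'.and (hT.eventually himg')).filter_mono nhdsWithin_le_nhds).and
      (self_mem_nhdsWithin (s := {0}ᶜ))).exists
  have heq : f z₁ = f z₂ := by
    have : f z₁ - f z₀ = f z₂ - f z₀ := by
      rw [hz1', hz2', hu1, hu2]
      simp only [mul_pow, hζ.pow_eq_one, one_mul]
    simpa using this
  have hz := hinj hz1 hz2 heq
  rw [hz, hu2] at hu1
  have : ζ = 1 := by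
    have hu0' : u ≠ 0 := hu0
    exact mul_right_cancel₀ hu0' (by simpa using hu1)
  exact hζ.ne_one hn this

theorem DifferentiableOn.invFunOn_of_injOn {f : ℂ → ℂ} {U : Set ℂ} (hU : IsOpen U)
    (hf : DifferentiableOn ℂ f U) (hinj : InjOn f U) :
    DifferentiableOn ℂ (Function.invFunOn f U) (f '' U) := by
  rintro _ ⟨a, ha, rfl⟩
  have hA : AnalyticAt ℂ f a := hf.analyticAt (hU.mem_nhds ha)
  have hd := hA.deriv_ne_zero_of_injOn (hU.mem_nhds ha) hinj
  have hleft : ∀ᶠ z in 𝓝 a, Function.invFunOn f U (f z) = z := by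
    filter_upwards [hU.mem_nhds ha] with z hz using hinj.leftInvOn_invFunOn hz
  have hmap := hA.hasStrictDerivAt.map_nhds_eq hd
  have hc : ContinuousAt (Function.invFunOn f U) (f a) := by
    rw [ContinuousAt, hleft.self_of_nhds, ← hmap, tendsto_map'_iff]
    exact tendsto_id.congr' (hleft.mono fun z hz => hz.symm)
  have hright : ∀ᶠ w in 𝓝 (f a), f (Function.invFunOn f U w) = w := by
    rw [← hmap, eventually_map]
    filter_upwards [hleft] with z hz
    rw [hz]
  refine (HasDerivAt.of_local_left_inverse hc (f := f) (f' := _root_.deriv f a) ?_ hd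
    hright).differentiableAt.differentiableWithinAt
  rw [hleft.self_of_nhds]
  exact hA.differentiableAt.hasDerivAt

/-- An automorphism of the unit disc that fixes the centre is a rotation. -/
theorem exists_rotation_of_leftInvOn_ball {f g : ℂ → ℂ}
    (hf : DifferentiableOn ℂ f (Metric.ball 0 1)) (hg : DifferentiableOn ℂ g (Metric.ball 0 1))
    (hfm : MapsTo f (Metric.ball 0 1) (Metric.ball 0 1))
    (hgm : MapsTo g (Metric.ball 0 1) (Metric.ball 0 1))
    (hf0 : f 0 = 0) (hg0 : g 0 = 0) (hgf : LeftInvOn g f (Metric.ball 0 1)) :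
    ∃ ζ : ℂ, ζ ≠ 0 ∧ ∀ u ∈ Metric.ball (0 : ℂ) 1, f u = ζ * u := by
  have hfm' : MapsTo f (Metric.ball 0 1) (Metric.closedBall (f 0) 1) := by
    rw [hf0]; exact hfm.mono_right Metric.ball_subset_closedBall
  have hhalf : (1 / 2 : ℂ) ∈ Metric.ball (0 : ℂ) 1 := by
    rw [mem_ball_zero_iff]; norm_num
  -- The Schwarz lemma for `f` and for its left inverse `g` gives the two inequalities; equality at
  -- one interior point forces a rotation.
  have hnorm : ‖f (1 / 2)‖ = 1 / 2 := by
    apply le_antisymm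
    · have := Complex.norm_le_norm_of_mapsTo_ball hf
        (hfm.mono_right Metric.ball_subset_closedBall) hf0 (mem_ball_zero_iff.1 hhalf)
      simpa using this
    · have := Complex.norm_le_norm_of_mapsTo_ball hg
        (hgm.mono_right Metric.ball_subset_closedBall) hg0 (mem_ball_zero_iff.1 (hfm hhalf))
      rw [hgf hhalf] at this
      simpa using this
  have hds : dslope f 0 (1 / 2) = 2 * f (1 / 2) := by
    rw [dslope_of_ne _ (by norm_num), slope_def_field, hf0]
    ring
  have haff := Complex.affine_of_mapsTo_ball_of_norm_dslope_eq_div hf hfm' hhalf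
    (by rw [hds, norm_mul, hnorm]; norm_num)
  refine ⟨dslope f 0 (1 / 2), ?_, fun u hu => ?_⟩
  · rw [hds]
    intro h
    have : ‖f (1 / 2)‖ = 0 := by simpa using h
    rw [hnorm] at this; norm_num at this
  · have := haff hu
    simp only [hf0, sub_zero, zero_add, smul_eq_mul] at this
    rw [this, mul_comm]

open ComplexConjugate in
theorem norm_cayley_lt_one {s z : ℂ} (hs : 0 < s.im) (hz : 0 < z.im) :
    ‖(z - s) / (z - conj s)‖ < 1 := by
  have hne : z - conj s ≠ 0 := by
    intro h
    have := congrArg Complex.im h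
    simp at this; linarith
  rw [norm_div, div_lt_one (norm_pos_iff.2 hne)]
  apply lt_of_pow_lt_pow_left₀ 2 (norm_nonneg _)
  rw [← Complex.normSq_eq_norm_sq, ← Complex.normSq_eq_norm_sq, Complex.normSq_apply,
    Complex.normSq_apply]
  simp
  nlinarith

open ComplexConjugate in
theorem im_inverse_cayley_pos {s u : ℂ} (hs : 0 < s.im) (hu : ‖u‖ < 1) :
    0 < ((s - conj s * u) / (1 - u)).im := by
  have hne : 1 - u ≠ 0 := by
    intro h
    rw [← sub_eq_zero.1 h] at hu
    simp at hu
  have h1 : Complex.normSq u < 1 := by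
    rw [Complex.normSq_eq_norm_sq]; nlinarith [norm_nonneg u]
  have h2 : 0 < Complex.normSq (1 - u) := Complex.normSq_pos.2 hne
  rw [Complex.div_im, ← sub_div]
  apply div_pos _ h2
  rw [Complex.normSq_apply] at h1
  simp
  nlinarith

open ComplexConjugate in
/-- Two conformal maps onto the half-plane differ by a Möbius transformation. -/
theorem IsConformalOntoHalfPlane.exists_mobius {Ω : Set ℂ} {φ ψ : ℂ → ℂ} (hΩ : IsOpen Ω)
    (hφ : IsConformalOntoHalfPlane Ω φ) (hψ : IsConformalOntoHalfPlane Ω ψ) :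
    ∃ A B C D : ℂ, A * D - B * C ≠ 0 ∧ ∀ z ∈ Ω, ψ z * (C * φ z + D) = A * φ z + B := by
  obtain ⟨z₀, hz₀, hφz⟩ := hφ.bijOn.surjOn (show Complex.I ∈ {z : ℂ | 0 < z.im} by simp)
  -- `f` is the transition map `ψ ∘ φ⁻¹` carried to the disc by the Cayley transforms centred at `φ
  -- z₀` and `ψ z₀`. Stated for arbitrary `φ`, `ψ`, it also supplies the inverse map.
  have key : ∀ (φ ψ : ℂ → ℂ), IsConformalOntoHalfPlane Ω φ → IsConformalOntoHalfPlane Ω ψ →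
      ∃ f : ℂ → ℂ, DifferentiableOn ℂ f (Metric.ball 0 1) ∧
        MapsTo f (Metric.ball 0 1) (Metric.ball 0 1) ∧
        ∀ z ∈ Ω, f ((φ z - φ z₀) / (φ z - conj (φ z₀))) =
          (ψ z - ψ z₀) / (ψ z - conj (ψ z₀)) := by
    intro φ ψ hφ hψ
    have ht : 0 < (φ z₀).im := hφ.bijOn.mapsTo hz₀
    have hs : 0 < (ψ z₀).im := hψ.bijOn.mapsTo hz₀
    set t := φ z₀
    set s := ψ z₀
    have hinv := DifferentiableOn.invFunOn_of_injOn hΩ hφ.differentiableOn hφ.bijOn.injOn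
    rw [hφ.bijOn.image_eq] at hinv
    have hinvm : MapsTo (Function.invFunOn φ Ω) {z : ℂ | 0 < z.im} Ω := fun w hw =>
      hφ.bijOn.surjOn.mapsTo_invFunOn hw
    have h1 : DifferentiableOn ℂ (fun u : ℂ => (t - conj t * u) / (1 - u)) (Metric.ball 0 1) := by
      refine DifferentiableOn.div (by fun_prop) (by fun_prop) ?_
      intro u hu h
      rw [mem_ball_zero_iff, ← sub_eq_zero.1 h] at hu
      simp at hu
    have h1m : MapsTo (fun u : ℂ => (t - conj t * u) / (1 - u)) (Metric.ball 0 1)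
        {z : ℂ | 0 < z.im} := fun u hu => im_inverse_cayley_pos ht (mem_ball_zero_iff.1 hu)
    have h2 : DifferentiableOn ℂ (fun z : ℂ => (z - s) / (z - conj s)) {z : ℂ | 0 < z.im} := by
      refine DifferentiableOn.div (by fun_prop) (by fun_prop) ?_
      intro z hz h
      have := congrArg Complex.im h
      have hz' : 0 < z.im := hz
      simp at this; linarith
    have h2m : MapsTo (fun z : ℂ => (z - s) / (z - conj s)) {z : ℂ | 0 < z.im}
        (Metric.ball 0 1) := fun z hz => mem_ball_zero_iff.2 (norm_cayley_lt_one hs hz)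
    refine ⟨fun u => (ψ (Function.invFunOn φ Ω ((t - conj t * u) / (1 - u))) - s) /
      (ψ (Function.invFunOn φ Ω ((t - conj t * u) / (1 - u))) - conj s), ?_, ?_, ?_⟩
    · exact (h2.comp (hψ.differentiableOn.comp (hinv.comp h1 h1m) (hinvm.comp h1m))
        (hψ.bijOn.mapsTo.comp (hinvm.comp h1m)))
    · exact h2m.comp (hψ.bijOn.mapsTo.comp (hinvm.comp h1m))
    · intro z hz
      have hz' : 0 < (φ z).im := hφ.bijOn.mapsTo hz
      have hne : φ z - conj t ≠ 0 := by
        intro h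
        have := congrArg Complex.im h
        simp at this; linarith
      have htt : t - conj t ≠ 0 := by
        intro h
        have := congrArg Complex.im h
        simp at this; linarith
      have : (t - conj t * ((φ z - t) / (φ z - conj t))) / (1 - (φ z - t) / (φ z - conj t)) =
          φ z := by
        have h3 : 1 - (φ z - t) / (φ z - conj t) = (t - conj t) / (φ z - conj t) := by
          field_simp; ring
        rw [h3]
        field_simp
        ring
      simp only [this, hφ.bijOn.injOn.leftInvOn_invFunOn hz]
  obtain ⟨f, hf, hfm, hfe⟩ := key φ ψ hφ hψ
  obtain ⟨g, hg, hgm, hge⟩ := key ψ φ hψ hφ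
  have ht : 0 < (φ z₀).im := hφ.bijOn.mapsTo hz₀
  have hs : 0 < (ψ z₀).im := hψ.bijOn.mapsTo hz₀
  have hgf : LeftInvOn g f (Metric.ball 0 1) := by
    intro u hu
    obtain ⟨z, hz, hzu⟩ := hφ.bijOn.surjOn (im_inverse_cayley_pos ht (mem_ball_zero_iff.1 hu))
    have hu1 : 1 - u ≠ 0 := by
      intro h
      rw [mem_ball_zero_iff, ← sub_eq_zero.1 h] at hu
      simp at hu
    have htt : φ z₀ - conj (φ z₀) ≠ 0 := by
      intro h
      have := congrArg Complex.im h
      simp at this; linarith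
    have : u = (φ z - φ z₀) / (φ z - conj (φ z₀)) := by
      have h3 : φ z - conj (φ z₀) = (φ z₀ - conj (φ z₀)) / (1 - u) := by
        rw [hzu]; field_simp; ring
      have h4 : φ z - φ z₀ = (φ z₀ - conj (φ z₀)) * u / (1 - u) := by
        rw [hzu]; field_simp; ring
      rw [h3, h4]
      field_simp
    rw [this, hfe z hz, hge z hz]
  obtain ⟨ζ, hζ, hfζ⟩ := exists_rotation_of_leftInvOn_ball hf hg hfm hgm
    (by simpa using hfe z₀ hz₀) (by simpa using hge z₀ hz₀) hgf
  set t := φ z₀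
  set s := ψ z₀
  -- The coefficients come from solving `(ψ - s) / (ψ - conj s) = ζ (φ - t) / (φ - conj t)` for `ψ`.
  refine ⟨s - ζ * conj s, ζ * t * conj s - s * conj t, 1 - ζ, ζ * t - conj t, ?_, ?_⟩
  · have : (s - ζ * conj s) * (ζ * t - conj t) - (ζ * t * conj s - s * conj t) * (1 - ζ) =
        ζ * ((s - conj s) * (t - conj t)) := by ring
    rw [this]
    refine mul_ne_zero hζ (mul_ne_zero ?_ ?_)
    · intro h
      have := congrArg Complex.im h
      simp at this; linarith
    · intro h
      have := congrArg Complex.im h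
      simp at this; linarith
  · intro z hz
    have hz1 : 0 < (φ z).im := hφ.bijOn.mapsTo hz
    have hz2 : 0 < (ψ z).im := hψ.bijOn.mapsTo hz
    have h1 : φ z - conj t ≠ 0 := by
      intro h
      have := congrArg Complex.im h
      simp at this; linarith
    have h2 : ψ z - conj s ≠ 0 := by
      intro h
      have := congrArg Complex.im h
      simp at this; linarith
    have h3 := hfe z hz
    rw [hfζ _ (mem_ball_zero_iff.2 (norm_cayley_lt_one ht hz1))] at h3
    field_simp at h3
    linear_combination -h3

/-- The relation and its derivative pass to the limit at `p`. The form without denominators allows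
this before `C a + D ≠ 0` is known; were it zero, `A a + B` would vanish too, against the
determinant condition. -/
theorem mobius_boundary_values {Ω : Set ℂ} {φ ψ : ℂ → ℂ} {p a a' c c' A B C D : ℂ}
    (hΩ : IsOpen Ω) (hp : p ∈ closure Ω) (hφd : DifferentiableOn ℂ φ Ω)
    (hψd : DifferentiableOn ℂ ψ Ω)
    (hφ : HasRegularBoundaryValue Ω φ p a a') (hψ : HasRegularBoundaryValue Ω ψ p c c')
    (hdet : A * D - B * C ≠ 0) (hrel : ∀ z ∈ Ω, ψ z * (C * φ z + D) = A * φ z + B) :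
    C * a + D ≠ 0 ∧ c * (C * a + D) = A * a + B ∧
      c' * (C * a + D) ^ 2 = (A * D - B * C) * a' := by
  have : (𝓝[Ω] p).NeBot := mem_closure_iff_nhdsWithin_neBot.1 hp
  have h1 : c * (C * a + D) = A * a + B := by
    refine tendsto_nhds_unique (hψ.tendsto_value.mul
      ((hφ.tendsto_value.const_mul C).add_const D)) ?_
    refine ((hφ.tendsto_value.const_mul A).add_const B).congr' ?_
    filter_upwards [self_mem_nhdsWithin] with z hz using (hrel z hz).symm
  have h2 : c' * (C * a + D) + c * (C * a') = A * a' := by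
    refine tendsto_nhds_unique ((hψ.tendsto_deriv.mul
      ((hφ.tendsto_value.const_mul C).add_const D)).add (hψ.tendsto_value.mul
        (hφ.tendsto_deriv.const_mul C))) ?_
    refine (hφ.tendsto_deriv.const_mul A).congr' ?_
    filter_upwards [self_mem_nhdsWithin] with z hz
    have e1 := (hψd.differentiableAt (hΩ.mem_nhds hz)).hasDerivAt
    have e2 := (hφd.differentiableAt (hΩ.mem_nhds hz)).hasDerivAt
    have e3 := e1.mul ((e2.const_mul C).add_const D)
    have e4 := (e2.const_mul A).add_const B
    have e5 := e4.congr_of_eventuallyEq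
      (f₁ := ψ * fun z => C * φ z + D) (by
        filter_upwards [hΩ.mem_nhds hz] with w hw using hrel w hw)
    exact (e3.unique e5).symm
  have h3 : C * a + D ≠ 0 := by
    intro h
    rw [h, mul_zero] at h1
    apply hdet
    linear_combination A * h + C * h1
  refine ⟨h3, h1, ?_⟩
  linear_combination (C * a + D) * h2 - C * a' * h1

/-- The renormalized energy does not depend on the conformal map. -/
theorem IsRenormalizedEnergyValue.unique {Ω : Set ℂ} {p q : ℂ} {v w : ℝ} (hΩ : IsOpen Ω)
    (hp : p ∈ closure Ω) (hq : q ∈ closure Ω)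
    (hv : IsRenormalizedEnergyValue Ω p q v) (hw : IsRenormalizedEnergyValue Ω p q w) :
    v = w := by
  obtain ⟨φ, a, b, a', b', hφ, hφp, hφq, rfl⟩ := hv
  obtain ⟨ψ, c, d, c', d', hψ, hψp, hψq, rfl⟩ := hw
  obtain ⟨A, B, C, D, hdet, hrel⟩ := hφ.exists_mobius hΩ hψ
  obtain ⟨p1, p2, p3⟩ := mobius_boundary_values hΩ hp hφ.differentiableOn hψ.differentiableOn
    hφp hψp hdet hrel
  obtain ⟨q1, q2, q3⟩ := mobius_boundary_values hΩ hq hφ.differentiableOn hψ.differentiableOn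
    hφq hψq hdet hrel
  have ha' := hφp.deriv_ne_zero
  have hb' := hφq.deriv_ne_zero
  have hc : c = (A * a + B) / (C * a + D) := by rw [eq_div_iff p1, p2]
  have hd : d = (A * b + B) / (C * b + D) := by rw [eq_div_iff q1, q2]
  have hc' : c' = (A * D - B * C) * a' / (C * a + D) ^ 2 := by
    rw [eq_div_iff (pow_ne_zero 2 p1), p3]
  have hd' : d' = (A * D - B * C) * b' / (C * b + D) ^ 2 := by
    rw [eq_div_iff (pow_ne_zero 2 q1), q3]
  congr 2
  -- Möbius invariance: the determinant and the factors `C a + D`, `C b + D` cancel.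
  have : (c - d) ^ 2 / (c' * d') = (a - b) ^ 2 / (a' * b') := by
    have : c - d = (A * D - B * C) * (a - b) / ((C * a + D) * (C * b + D)) := by
      rw [hc, hd, div_sub_div _ _ p1 q1]; congr 1; ring
    rw [this, hc', hd']
    field_simp
  have h := congrArg norm this
  simpa [norm_div, norm_mul, norm_pow] using h.symm

/-! ### Elliptic functions: the product formula for `℘'`. -/

namespace PeriodPair

variable (P : PeriodPair)

theorem eventually_notMem_lattice (c : ℂ) : ∀ᶠ z in 𝓝[≠] c, z ∉ P.lattice := by
  filter_upwards [self_mem_nhdsWithin,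
    mem_nhdsWithin_of_mem_nhds (P.compl_lattice_sdiff_singleton_mem_nhds c)] with z hz hz'
  exact fun h => hz' ⟨h, hz⟩

theorem eventually_add_notMem_lattice (c a : ℂ) : ∀ᶠ z in 𝓝[≠] c, z + a ∉ P.lattice := by
  have : Tendsto (fun z => z + a) (𝓝[≠] c) (𝓝[≠] (c + a)) := by
    refine tendsto_nhdsWithin_iff.2 ⟨?_, ?_⟩
    · exact ((continuous_add_const a).tendsto c).mono_left nhdsWithin_le_nhds
    · filter_upwards [self_mem_nhdsWithin] with z hz
      simpa using hz
  exact this.eventually (P.eventually_notMem_lattice (c + a))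

/-- An odd elliptic function with only removable singularities vanishes. -/
theorem eq_zero_of_odd_of_removable {f : ℂ → ℂ}
    (hd : ∀ c, ∀ᶠ z in 𝓝[≠] c, DifferentiableAt ℂ f z)
    (hr : ∀ c, Tendsto (fun z => (z - c) * f z) (𝓝[≠] c) (𝓝 0))
    (hper : ∀ l ∈ P.lattice, ∀ z, f (z + l) = f z) (hodd : ∀ z, f (-z) = -f z) {z : ℂ}
    (hz : ContinuousAt f z) : f z = 0 := by
  -- `g` is `f` with its singularities removed: entire and periodic, hence bounded and constant by
  -- Liouville, hence zero by oddness.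
  set g : ℂ → ℂ := fun c => limUnder (𝓝[≠] c) f with hg
  have hlo : ∀ c, (fun z => f z - f c) =o[𝓝[≠] c] fun z => (z - c)⁻¹ := by
    intro c
    rw [Asymptotics.isLittleO_iff_tendsto']
    · have h1 : Tendsto (fun z => (z - c) * f z - (z - c) * f c) (𝓝[≠] c) (𝓝 (0 - (c - c) * f c)) :=
        (hr c).sub (Tendsto.mono_left (Continuous.tendsto (by fun_prop) c) nhdsWithin_le_nhds)
      simp only [sub_self, zero_mul] at h1
      refine h1.congr fun z => ?_
      rw [div_inv_eq_mul]; ring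
    · filter_upwards [self_mem_nhdsWithin] with z hz h
      exact absurd (inv_eq_zero.1 h) (sub_ne_zero.2 hz)
  have hlim : ∀ c, Tendsto f (𝓝[≠] c) (𝓝 (g c)) := fun c =>
    Complex.tendsto_limUnder_of_differentiable_on_punctured_nhds_of_isLittleO (hd c) (hlo c)
  have hcont : ∀ {c}, ContinuousAt f c → g c = f c := fun {c} hc =>
    tendsto_nhds_unique (hlim c) (hc.tendsto.mono_left nhdsWithin_le_nhds)
  have hgd : Differentiable ℂ g := by
    intro c
    have hdc := hd c
    rw [eventually_nhdsWithin_iff] at hdc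
    have H := Complex.differentiableOn_update_limUnder_of_isLittleO hdc
      (fun z hz => (hz.1 hz.2).differentiableWithinAt) (hlo c)
    refine (H.differentiableAt hdc).congr_of_eventuallyEq ?_
    filter_upwards [hdc] with z hz
    by_cases hzc : z = c
    · subst hzc; simp [hg]
    · rw [Function.update_of_ne hzc]
      exact hcont (hz hzc).continuousAt
  have hgper : ∀ z, ∀ l ∈ P.lattice, g (z + l) = g z := by
    intro z l hl
    have : Tendsto (fun z => z + l) (𝓝[≠] z) (𝓝[≠] (z + l)) := by
      refine tendsto_nhdsWithin_iff.2 ⟨?_, ?_⟩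
      · exact ((continuous_add_const l).tendsto z).mono_left nhdsWithin_le_nhds
      · filter_upwards [self_mem_nhdsWithin] with z hz
        simpa using hz
    refine tendsto_nhds_unique ((hlim (z + l)).comp this) ((hlim z).congr fun w => ?_)
    simp [hper l hl]
  have hgodd : ∀ z, g (-z) = -g z := by
    intro z
    have : Tendsto (fun z : ℂ => -z) (𝓝[≠] z) (𝓝[≠] (-z)) := by
      refine tendsto_nhdsWithin_iff.2 ⟨?_, ?_⟩
      · exact (continuous_neg.tendsto z).mono_left nhdsWithin_le_nhds
      · filter_upwards [self_mem_nhdsWithin] with z hz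
        simpa using hz
    refine tendsto_nhds_unique ((hlim (-z)).comp this) ((hlim z).neg.congr fun w => ?_)
    simp [hodd]
  have hbdd := (IsZLattice.isCompact_range_of_periodic P.lattice g hgd.continuous hgper).isBounded
  have h1 := hgd.apply_eq_apply_of_bounded hbdd z (-z)
  rw [hgodd] at h1
  rw [← hcont hz]
  exact CharZero.eq_neg_self_iff.1 h1

open scoped PeriodPair

theorem weierstrassP_eq_inv_sq_add (z : ℂ) : ℘[P] z = (z ^ 2)⁻¹ + ℘[P - (0 : ℂ)] z := by
  have := P.weierstrassPExcept_def 0 z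
  simp only [ZeroMemClass.coe_zero] at this
  rw [this]; simp

theorem derivWeierstrassP_eq_inv_cube_add (z : ℂ) :
    ℘'[P] z = -2 * (z ^ 3)⁻¹ + ℘'[P - (0 : ℂ)] z := by
  have := P.derivWeierstrassPExcept_def 0 z
  simp only [ZeroMemClass.coe_zero] at this
  rw [this]; simp; ring

theorem weierstrassP_add {l : ℂ} (hl : l ∈ P.lattice) (z : ℂ) : ℘[P] (z + l) = ℘[P] z :=
  P.weierstrassP_add_coe z ⟨l, hl⟩

theorem derivWeierstrassP_add {l : ℂ} (hl : l ∈ P.lattice) (z : ℂ) : ℘'[P] (z + l) = ℘'[P] z :=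
  P.derivWeierstrassP_add_coe z ⟨l, hl⟩

theorem differentiableAt_weierstrassP {z : ℂ} (hz : z ∉ P.lattice) :
    DifferentiableAt ℂ ℘[P] z :=
  (P.analyticOnNhd_weierstrassP z hz).differentiableAt

theorem differentiableAt_derivWeierstrassP {z : ℂ} (hz : z ∉ P.lattice) :
    DifferentiableAt ℂ ℘'[P] z :=
  (P.analyticOnNhd_derivWeierstrassP z hz).differentiableAt

theorem hasDerivAt_weierstrassP {z : ℂ} (hz : z ∉ P.lattice) :
    HasDerivAt ℘[P] (℘'[P] z) z := by
  rw [← P.deriv_weierstrassP]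
  exact (P.differentiableAt_weierstrassP hz).hasDerivAt

/-- Differentiate `℘'² = 4℘³ - g₂℘ - g₃` and cancel `2℘'`. -/
theorem deriv_derivWeierstrassP {z : ℂ} (hz : z ∉ P.lattice) (hz' : ℘'[P] z ≠ 0) :
    deriv ℘'[P] z = 6 * ℘[P] z ^ 2 - P.g₂ / 2 := by
  have h1 := P.hasDerivAt_weierstrassP hz
  have h2 := (P.differentiableAt_derivWeierstrassP hz).hasDerivAt
  have h3 : HasDerivAt (fun z => 4 * ℘[P] z ^ 3 - P.g₂ * ℘[P] z - P.g₃)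
      (4 * (3 * ℘[P] z ^ 2 * ℘'[P] z) - P.g₂ * ℘'[P] z) z := by
    simpa using (((h1.pow 3).const_mul 4).sub (h1.const_mul P.g₂)).sub_const P.g₃
  have h4 : HasDerivAt (fun z => ℘'[P] z ^ 2) (2 * ℘'[P] z * deriv ℘'[P] z) z := by
    simpa using h2.fun_pow 2
  have h5 := h4.unique (h3.congr_of_eventuallyEq (by
    filter_upwards [P.isClosed_lattice.isOpen_compl.mem_nhds hz] with w hw
    exact P.derivWeierstrassP_sq w hw))
  apply mul_left_cancel₀ (mul_ne_zero two_ne_zero hz')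
  linear_combination h5

theorem iteratedDeriv_three_weierstrassP {z : ℂ} (hz : z ∉ P.lattice) (hz' : ℘'[P] z ≠ 0) :
    iteratedDeriv 3 ℘[P] z = 12 * ℘[P] z * ℘'[P] z := by
  rw [iteratedDeriv_succ', iteratedDeriv_succ', iteratedDeriv_one, P.deriv_weierstrassP]
  have h1 : deriv ℘'[P] =ᶠ[𝓝 z] fun z => 6 * ℘[P] z ^ 2 - P.g₂ / 2 := by
    filter_upwards [P.isClosed_lattice.isOpen_compl.mem_nhds hz,
      (P.differentiableAt_derivWeierstrassP hz).continuousAt.eventually_ne hz'] with w hw hw'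
    exact P.deriv_derivWeierstrassP hw hw'
  rw [h1.deriv_eq]
  have h3 : HasDerivAt (fun z => 6 * ℘[P] z ^ 2 - P.g₂ / 2) (6 * (2 * ℘[P] z * ℘'[P] z)) z := by
    simpa using (((P.hasDerivAt_weierstrassP hz).pow 2).const_mul 6).sub_const (P.g₂ / 2)
  rw [h3.deriv]; ring

end PeriodPair

/-- Even Taylor terms cancel in `f (w - y) - f (w + y)`. Precision `o(y³)` is what is needed against
the fourth-order pole of `(℘(z) - ℘(w))²` at `0`, after multiplication by `z`. -/
theorem AnalyticAt.tendsto_odd_taylor_remainder {f : ℂ → ℂ} {w : ℂ} (hf : AnalyticAt ℂ f w) :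
    Tendsto (fun y => (f (w - y) - f (w + y) + 2 * deriv f w * y +
      iteratedDeriv 3 f w / 3 * y ^ 3) / y ^ 3) (𝓝[≠] 0) (𝓝 0) := by
  have h := hf.hasFPowerSeriesAt.isBigO_sub_partialSum_pow 4
  have hneg : Tendsto (fun y : ℂ => -y) (𝓝 0) (𝓝 0) := by
    simpa using (continuous_neg (G := ℂ)).tendsto 0
  have h' := (h.comp_tendsto hneg).sub (h.congr_right fun y => by rw [← norm_neg y]; rfl)
  have h2 : (fun y => f (w - y) - f (w + y) + 2 * deriv f w * y +
      iteratedDeriv 3 f w / 3 * y ^ 3) =O[𝓝 0] fun y : ℂ => y ^ 4 := by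
    have h3 : (fun y : ℂ => ‖y‖ ^ 4) =O[𝓝 0] fun y : ℂ => y ^ 4 :=
      Asymptotics.isBigO_of_le _ fun y => by simp
    refine Asymptotics.IsBigO.trans ?_ h3
    refine h'.congr (fun y => ?_) (fun y => ?_)
    · simp [FormalMultilinearSeries.partialSum, Finset.sum_range_succ,
        FormalMultilinearSeries.ofScalars, ← sub_eq_add_neg, Nat.factorial]
      ring
    · simp
  have h4 : (fun y : ℂ => y ^ 4) =o[𝓝[≠] 0] fun y : ℂ => y ^ 3 :=
    (Asymptotics.isLittleO_pow_pow (by norm_num)).mono nhdsWithin_le_nhds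
  exact ((h2.mono nhdsWithin_le_nhds).trans_isLittleO h4).tendsto_div_nhds_zero

namespace PeriodPair

open scoped PeriodPair

variable (P : PeriodPair)

theorem two_mul_notMem_lattice {w : ℂ} (hw' : ℘'[P] w ≠ 0) : 2 * w ∉ P.lattice := by
  intro h
  have h1 := P.derivWeierstrassP_add h (-w)
  rw [show -w + 2 * w = w by ring, P.derivWeierstrassP_neg] at h1
  exact hw' (CharZero.eq_neg_self_iff.1 h1)

/-- The difference of the two sides of the identity
`℘'(z) ℘'(w) = (℘(z) - ℘(w))² (℘(z - w) - ℘(z + w))`. -/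
noncomputable def productDefect (w z : ℂ) : ℂ :=
  (℘[P] z - ℘[P] w) ^ 2 * (℘[P] (z - w) - ℘[P] (z + w)) - ℘'[P] z * ℘'[P] w

theorem productDefect_neg (w z : ℂ) : P.productDefect w (-z) = -P.productDefect w z := by
  simp only [productDefect, P.weierstrassP_neg, P.derivWeierstrassP_neg]
  rw [show -z - w = -(z + w) by ring, show -z + w = -(z - w) by ring, P.weierstrassP_neg,
    P.weierstrassP_neg]
  ring

theorem productDefect_add (w : ℂ) {l : ℂ} (hl : l ∈ P.lattice) (z : ℂ) :
    P.productDefect w (z + l) = P.productDefect w z := by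
  simp only [productDefect, P.weierstrassP_add hl, P.derivWeierstrassP_add hl]
  rw [show z + l - w = z - w + l by ring, show z + l + w = z + w + l by ring,
    P.weierstrassP_add hl, P.weierstrassP_add hl]

theorem differentiableAt_productDefect {w z : ℂ} (h : z ∉ P.lattice) (h1 : z - w ∉ P.lattice)
    (h2 : z + w ∉ P.lattice) : DifferentiableAt ℂ (P.productDefect w) z := by
  have e1 := P.differentiableAt_weierstrassP h
  have e2 := P.differentiableAt_derivWeierstrassP h
  have e3 : DifferentiableAt ℂ (fun z => ℘[P] (z - w)) z :=
    DifferentiableAt.comp z (P.differentiableAt_weierstrassP h1) (by fun_prop)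
  have e4 : DifferentiableAt ℂ (fun z => ℘[P] (z + w)) z :=
    DifferentiableAt.comp z (P.differentiableAt_weierstrassP h2) (by fun_prop)
  unfold productDefect
  fun_prop

theorem tendsto_mul_productDefect_zero {w : ℂ} (hw : w ∉ P.lattice) (hw' : ℘'[P] w ≠ 0) :
    Tendsto (fun z => z * P.productDefect w z) (𝓝[≠] 0) (𝓝 0) := by
  have hT := (P.analyticOnNhd_weierstrassP w hw).tendsto_odd_taylor_remainder
  rw [P.iteratedDeriv_three_weierstrassP hw hw', P.deriv_weierstrassP] at hT
  set W := ℘[P] w with hW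
  set W' := ℘'[P] w with hW'
  set p := ℘[P - (0 : ℂ)] with hp
  set p' := ℘'[P - (0 : ℂ)] with hp'
  have hpc : ContinuousAt p 0 := (P.analyticAt_weierstrassPExcept 0).continuousAt
  have hpc' : ContinuousAt p' 0 := (P.analyticAt_derivWeierstrassPExcept 0).continuousAt
  have hp0 : p 0 = 0 := P.weierstrassPExcept_zero 0
  -- `R` is what remains of `z * productDefect` apart from the Taylor remainder, once the two `z⁻²`
  -- terms `∓2W'z⁻²` have cancelled. Its value at `0` is `-4WW' + 4WW' = 0`, the first term coming
  -- from `℘''' = 12℘℘'`.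
  set R : ℂ → ℂ := fun z => -4 * W * W' * (1 + z ^ 2 * (p z - W)) ^ 2 +
    (-2 * W') * (2 * (p z - W) + z ^ 2 * (p z - W) ^ 2) - z * p' z * W' with hR
  have hRc : ContinuousAt R 0 := by fun_prop
  have hR0 : R 0 = 0 := by simp [hR, hp0]; ring
  have hSc : ContinuousAt (fun z => (1 + z ^ 2 * (p z - W)) ^ 2) 0 := by fun_prop
  have hlim := (hT.mul (hSc.tendsto.mono_left nhdsWithin_le_nhds)).add
    (hRc.tendsto.mono_left nhdsWithin_le_nhds)
  rw [hR0, zero_mul, add_zero] at hlim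
  refine hlim.congr' ?_
  filter_upwards [self_mem_nhdsWithin] with z hz
  have hz0 : z ≠ 0 := hz
  simp only [productDefect]
  rw [show z - w = -(w - z) by ring, P.weierstrassP_neg, show z + w = w + z by ring,
    P.weierstrassP_eq_inv_sq_add z, P.derivWeierstrassP_eq_inv_cube_add z, ← hW, ← hW', ← hp,
    ← hp', hR]
  field_simp
  ring

/-- The factor `(℘(z) - ℘(w))²` vanishes to second order at `w` and absorbs the double pole of `℘(z
- w)`; the other terms are regular there. -/
theorem tendsto_mul_productDefect_self {w : ℂ} (hw : w ∉ P.lattice) (hw' : ℘'[P] w ≠ 0) :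
    Tendsto (fun z => (z - w) * P.productDefect w z) (𝓝[≠] w) (𝓝 0) := by
  set p := ℘[P - (0 : ℂ)] with hp
  have hpc : ContinuousAt (fun z => p (z - w)) w := by
    have h0 : ContinuousAt p (w - w) := by
      rw [sub_self]
      exact (P.analyticAt_weierstrassPExcept 0).continuousAt
    exact ContinuousAt.comp (f := fun z => z - w) h0 (by fun_prop)
  have hd := P.differentiableAt_weierstrassP hw
  have hds : ContinuousAt (dslope ℘[P] w) w := continuousAt_dslope_same.2 hd
  have hc' : ContinuousAt ℘'[P] w := (P.differentiableAt_derivWeierstrassP hw).continuousAt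
  have hc2 : ContinuousAt (fun z => ℘[P] (z + w)) w := by
    have h0 : ContinuousAt ℘[P] (w + w) := by
      rw [← two_mul]
      exact (P.differentiableAt_weierstrassP (P.two_mul_notMem_lattice hw')).continuousAt
    exact ContinuousAt.comp (f := fun z => z + w) h0 (by fun_prop)
  set R : ℂ → ℂ := fun z => (z - w) * (dslope ℘[P] w z ^ 2 *
    (1 + (z - w) ^ 2 * (p (z - w) - ℘[P] (z + w))) - ℘'[P] z * ℘'[P] w) with hR
  have hsub : ContinuousAt (fun z => z - w) w := by fun_prop
  have hRc : ContinuousAt R w :=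
    hsub.mul (((hds.pow 2).mul (continuousAt_const.add ((hsub.pow 2).mul (hpc.sub hc2)))).sub
      (hc'.mul continuousAt_const))
  have hR0 : R w = 0 := by simp [hR]
  have hlim := hRc.tendsto.mono_left (nhdsWithin_le_nhds (s := {w}ᶜ))
  rw [hR0] at hlim
  refine hlim.congr' ?_
  filter_upwards [self_mem_nhdsWithin] with z hz
  have hz0 : z - w ≠ 0 := sub_ne_zero.2 hz
  simp only [productDefect]
  rw [P.weierstrassP_eq_inv_sq_add (z - w), ← hp, hR]
  have h1 : ℘[P] z - ℘[P] w = (z - w) * dslope ℘[P] w z := by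
    have := sub_smul_dslope ℘[P] w z
    rw [← this, smul_eq_mul]
  rw [h1]
  field_simp
  ring

/-- Singularities can occur only at `0` and `±w` modulo the lattice. Oddness carries the analysis at
`w` to `-w`, and periodicity carries it to all translates. -/
theorem productDefect_eq_zero {w z : ℂ} (hw : w ∉ P.lattice) (hw' : ℘'[P] w ≠ 0)
    (hz : z ∉ P.lattice) (h1 : z - w ∉ P.lattice) (h2 : z + w ∉ P.lattice) :
    P.productDefect w z = 0 := by
  refine P.eq_zero_of_odd_of_removable (f := P.productDefect w) ?_ ?_
    (fun l hl z => P.productDefect_add w hl z) (P.productDefect_neg w)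
    (P.differentiableAt_productDefect hz h1 h2).continuousAt
  · intro c
    filter_upwards [P.eventually_notMem_lattice c, P.eventually_add_notMem_lattice c w,
      P.eventually_add_notMem_lattice c (-w)] with z e1 e2 e3
    exact P.differentiableAt_productDefect e1 (by rwa [sub_eq_add_neg]) e2
  · have shift : ∀ c l, l ∈ P.lattice →
        Tendsto (fun z => (z - c) * P.productDefect w z) (𝓝[≠] c) (𝓝 0) →
        Tendsto (fun z => (z - (c + l)) * P.productDefect w z) (𝓝[≠] (c + l)) (𝓝 0) := by
      intro c l hl h
      have ht : Tendsto (fun z => z - l) (𝓝[≠] (c + l)) (𝓝[≠] c) := by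
        refine tendsto_nhdsWithin_iff.2 ⟨?_, ?_⟩
        · have : Tendsto (fun z => z - l) (𝓝 (c + l)) (𝓝 (c + l - l)) :=
            Continuous.tendsto (by fun_prop) _
          rw [add_sub_cancel_right] at this
          exact this.mono_left nhdsWithin_le_nhds
        · filter_upwards [self_mem_nhdsWithin] with z hz h
          exact hz (by rw [mem_singleton_iff] at h ⊢; rw [← h]; ring)
      refine (h.comp ht).congr fun z => ?_
      simp only [Function.comp]
      rw [← P.productDefect_add w hl (z - l), sub_add_cancel]
      ring
    have hneg : Tendsto (fun z => (z - -w) * P.productDefect w z) (𝓝[≠] (-w)) (𝓝 0) := by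
      have ht : Tendsto (fun z : ℂ => -z) (𝓝[≠] (-w)) (𝓝[≠] w) := by
        refine tendsto_nhdsWithin_iff.2 ⟨?_, ?_⟩
        · have : Tendsto (fun z : ℂ => -z) (𝓝 (-w)) (𝓝 (- -w)) := Continuous.tendsto (by fun_prop) _
          rw [neg_neg] at this
          exact this.mono_left nhdsWithin_le_nhds
        · filter_upwards [self_mem_nhdsWithin] with z hz h
          exact hz (by rw [mem_singleton_iff] at h ⊢; rw [← h]; ring)
      refine ((P.tendsto_mul_productDefect_self hw hw').comp ht).congr fun z => ?_
      simp only [Function.comp, productDefect_neg]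
      ring
    intro c
    by_cases hc : c ∈ P.lattice
    · simpa using shift 0 c hc (by simpa using P.tendsto_mul_productDefect_zero hw hw')
    by_cases hc1 : c - w ∈ P.lattice
    · simpa using shift w _ hc1 (P.tendsto_mul_productDefect_self hw hw')
    by_cases hc2 : c + w ∈ P.lattice
    · simpa using shift (-w) _ hc2 hneg
    · have hc := (P.differentiableAt_productDefect hc hc1 hc2).continuousAt
      have : ContinuousAt (fun z => (z - c) * P.productDefect w z) c := by fun_prop
      simpa using this.tendsto.mono_left (nhdsWithin_le_nhds (s := {c}ᶜ))

theorem derivWeierstrassP_mul {w z : ℂ} (hw : w ∉ P.lattice) (hw' : ℘'[P] w ≠ 0)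
    (hz : z ∉ P.lattice) (h1 : z - w ∉ P.lattice) (h2 : z + w ∉ P.lattice) :
    ℘'[P] z * ℘'[P] w = (℘[P] z - ℘[P] w) ^ 2 * (℘[P] (z - w) - ℘[P] (z + w)) :=
  (sub_eq_zero.1 (P.productDefect_eq_zero hw hw' hz h1 h2)).symm

/-! ### Zeros of `℘'` and fibres of `℘`. -/

theorem isPreconnected_compl_lattice : IsPreconnected ((P.lattice : Set ℂ)ᶜ) := by
  have hcount : (P.lattice : Set ℂ).Countable := by
    have : Countable P.lattice := P.latticeEquivProd.toEquiv.countable_iff.2 inferInstance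
    exact this.to_set
  exact (hcount.isPathConnected_compl_of_one_lt_rank (by simp)).isConnected.isPreconnected

theorem tendsto_sq_mul_weierstrassP :
    Tendsto (fun z => z ^ 2 * ℘[P] z) (𝓝[≠] 0) (𝓝 1) := by
  have hpc : ContinuousAt ℘[P - (0 : ℂ)] 0 := (P.analyticAt_weierstrassPExcept 0).continuousAt
  have h : ContinuousAt (fun z => 1 + z ^ 2 * ℘[P - (0 : ℂ)] z) 0 := by fun_prop
  have h' := h.tendsto.mono_left (nhdsWithin_le_nhds (s := {0}ᶜ))
  simp only [ne_eq, OfNat.ofNat_ne_zero, not_false_eq_true, zero_pow, zero_mul, add_zero] at h'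
  refine h'.congr' ?_
  filter_upwards [self_mem_nhdsWithin] with z hz
  have hz0 : z ≠ 0 := hz
  rw [P.weierstrassP_eq_inv_sq_add z]
  field_simp

theorem tendsto_weierstrassP_cobounded :
    Tendsto ℘[P] (𝓝[≠] 0) (Bornology.cobounded ℂ) := by
  rw [← tendsto_norm_atTop_iff_cobounded]
  have h1 : Tendsto (fun z : ℂ => ‖(z ^ 2)⁻¹‖) (𝓝[≠] 0) atTop := by
    have : Tendsto (fun z : ℂ => ‖z‖⁻¹ ^ 2) (𝓝[≠] 0) atTop :=
      (tendsto_pow_atTop two_ne_zero).comp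
        (tendsto_inv_nhdsGT_zero.comp (tendsto_norm_nhdsNE_zero (E := ℂ)))
    simpa using this
  have h2 := h1.atTop_mul_pos one_pos (by simpa using P.tendsto_sq_mul_weierstrassP.norm)
  refine h2.congr' ?_
  filter_upwards [self_mem_nhdsWithin] with z hz
  have hz0 : z ≠ 0 := hz
  rw [← norm_pow, norm_inv]
  have : ‖z ^ 2‖ ≠ 0 := norm_ne_zero_iff.2 (pow_ne_zero 2 hz0)
  field_simp

/-- Otherwise `℘'` would vanish on the whole connected complement of the lattice, whereas `z³ ℘'(z)
→ -2` at `0`. -/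
theorem eventually_derivWeierstrassP_ne_zero {z : ℂ} (hz : z ∉ P.lattice) :
    ∀ᶠ w in 𝓝[≠] z, ℘'[P] w ≠ 0 := by
  rcases (P.analyticOnNhd_derivWeierstrassP z hz).eventually_eq_zero_or_eventually_ne_zero with h | h
  · exfalso
    have h0 : EqOn ℘'[P] 0 (P.lattice : Set ℂ)ᶜ :=
      P.analyticOnNhd_derivWeierstrassP.eqOn_zero_of_preconnected_of_eventuallyEq_zero
        P.isPreconnected_compl_lattice hz h
    have hpc : ContinuousAt ℘'[P - (0 : ℂ)] 0 :=
      (P.analyticAt_derivWeierstrassPExcept 0).continuousAt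
    have hc : ContinuousAt (fun z => -2 + z ^ 3 * ℘'[P - (0 : ℂ)] z) 0 := by fun_prop
    have hc' := hc.tendsto.mono_left (nhdsWithin_le_nhds (s := {0}ᶜ))
    simp only [ne_eq, OfNat.ofNat_ne_zero, not_false_eq_true, zero_pow, zero_mul, add_zero] at hc'
    have : Tendsto (fun _ : ℂ => (0 : ℂ)) (𝓝[≠] 0) (𝓝 (-2)) := by
      refine hc'.congr' ?_
      filter_upwards [self_mem_nhdsWithin, P.eventually_notMem_lattice 0] with z hz hz'
      have hz0 : z ≠ 0 := hz
      have h1 := h0 hz'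
      rw [P.derivWeierstrassP_eq_inv_cube_add z] at h1
      simp only [Pi.zero_apply] at h1
      have : z ^ 3 * (-2 * (z ^ 3)⁻¹ + ℘'[P - (0 : ℂ)] z) = 0 := by rw [h1, mul_zero]
      rw [mul_add, ← mul_assoc, mul_comm (z ^ 3) (-2), mul_assoc,
        mul_inv_cancel₀ (pow_ne_zero 3 hz0), mul_one] at this
      exact this
    have := tendsto_nhds_unique this tendsto_const_nhds
    norm_num at this
  · exact h

/-- If `℘'(z) = 0`, the product formula gives `℘(z + w) = ℘(z - w)` for `w ≠ z` near `z`. As `w → z`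
the left side tends to the finite value `℘(2z)` and the right side to infinity. -/
theorem derivWeierstrassP_ne_zero {z : ℂ} (hz2 : 2 * z ∉ P.lattice) :
    ℘'[P] z ≠ 0 := by
  have hz : z ∉ P.lattice := fun h => hz2 (by rw [two_mul]; exact add_mem h h)
  intro h0
  have hsub : Tendsto (fun w => z - w) (𝓝[≠] z) (𝓝[≠] 0) := by
    refine tendsto_nhdsWithin_iff.2 ⟨?_, ?_⟩
    · have : Tendsto (fun w => z - w) (𝓝 z) (𝓝 (z - z)) := Continuous.tendsto (by fun_prop) _
      rw [sub_self] at this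
      exact this.mono_left nhdsWithin_le_nhds
    · filter_upwards [self_mem_nhdsWithin] with w hw h
      exact hw (sub_eq_zero.1 h).symm
  have hadd : ContinuousAt (fun w => ℘[P] (z + w)) z := by
    have h0 : ContinuousAt ℘[P] (z + z) := by
      rw [← two_mul]
      exact (P.differentiableAt_weierstrassP hz2).continuousAt
    exact ContinuousAt.comp (f := fun w => z + w) h0 (by fun_prop)
  have hne : ∀ᶠ w in 𝓝[≠] z, ℘[P] w - ℘[P] z ≠ 0 := by
    have hA : AnalyticAt ℂ (fun w => ℘[P] w - ℘[P] z) z := by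
      have := P.analyticOnNhd_weierstrassP z hz
      fun_prop
    rcases hA.eventually_eq_zero_or_eventually_ne_zero with h | h
    · exfalso
      have h1 : ∀ᶠ w in 𝓝 z, ℘'[P] w = 0 := by
        filter_upwards [eventually_eventually_nhds.2 h] with w hw
        have h2 : ℘[P] =ᶠ[𝓝 w] fun _ => ℘[P] z := by
          filter_upwards [hw] with u hu using sub_eq_zero.1 hu
        rw [← P.deriv_weierstrassP, h2.deriv_eq, deriv_const]
      obtain ⟨w, hw, hw'⟩ := ((h1.filter_mono nhdsWithin_le_nhds).and
        (P.eventually_derivWeierstrassP_ne_zero hz)).exists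
      exact hw' hw
    · exact h
  have heq : ∀ᶠ w in 𝓝[≠] z, ℘[P] (z + w) = ℘[P] (z - w) := by
    have h2 : ∀ᶠ w in 𝓝 z, z + w ∉ P.lattice := by
      have : ContinuousAt (fun w => z + w) z := by fun_prop
      exact this.eventually_mem (P.isClosed_lattice.isOpen_compl.mem_nhds
        (by rwa [← two_mul]))
    filter_upwards [hne, P.eventually_notMem_lattice z, P.eventually_derivWeierstrassP_ne_zero hz,
      hsub.eventually (P.eventually_notMem_lattice 0), nhdsWithin_le_nhds h2] with w e1 e2 e3 e4 e5
    have := P.derivWeierstrassP_mul e2 e3 hz e4 e5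
    rw [h0, zero_mul] at this
    rcases mul_eq_zero.1 this.symm with h | h
    · exact absurd (sub_eq_zero.1 (pow_eq_zero_iff two_ne_zero |>.1 h)) fun h => e1 (by rw [h, sub_self])
    · exact (sub_eq_zero.1 h).symm
  have h1 := P.tendsto_weierstrassP_cobounded.comp hsub
  have h2 := (hadd.tendsto.mono_left (nhdsWithin_le_nhds (s := {z}ᶜ))).congr' heq
  exact h2.not_tendsto (Metric.disjoint_nhds_cobounded _) h1

/-- Equal values would annihilate the right side of the product formula, while the left side is
nonzero. -/
theorem weierstrassP_ne {z w : ℂ} (hz : 2 * z ∉ P.lattice) (hw : 2 * w ∉ P.lattice)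
    (h1 : z - w ∉ P.lattice) (h2 : z + w ∉ P.lattice) : ℘[P] z ≠ ℘[P] w := by
  intro h
  have hz' : z ∉ P.lattice := fun h => hz (by rw [two_mul]; exact add_mem h h)
  have hw' : w ∉ P.lattice := fun h => hw (by rw [two_mul]; exact add_mem h h)
  have := P.derivWeierstrassP_mul hw' (P.derivWeierstrassP_ne_zero hw) hz' h1 h2
  rw [h, sub_self, zero_pow two_ne_zero, zero_mul] at this
  exact mul_ne_zero (P.derivWeierstrassP_ne_zero hz) (P.derivWeierstrassP_ne_zero hw) this

open ComplexConjugate in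
theorem weierstrassP_conj (hP : ∀ l ∈ P.lattice, conj l ∈ P.lattice) (z : ℂ) :
    ℘[P] (conj z) = conj (℘[P] z) := by
  let e : P.lattice ≃ P.lattice :=
    { toFun := fun l => ⟨conj l.1, hP _ l.2⟩
      invFun := fun l => ⟨conj l.1, hP _ l.2⟩
      left_inv := fun l => by simp
      right_inv := fun l => by simp }
  simp only [weierstrassP]
  rw [Complex.conj_tsum, ← e.tsum_eq]
  simp [e]

end PeriodPair

/-! ### The conformal map of the rectangle and the energy formula. -/

/-- The periods `2L` and `2iH` of the elliptic functions adapted to `openRectangle L H`. -/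
noncomputable def rectanglePeriods (L H : ℝ) (hL : 0 < L) (hH : 0 < H) : PeriodPair where
  ω₁ := ⟨2 * L, 0⟩
  ω₂ := ⟨0, 2 * H⟩
  indep := by
    rw [LinearIndependent.pair_iff]
    intro s t h
    have h1 := congrArg Complex.re h
    have h2 := congrArg Complex.im h
    simp at h1 h2
    exact ⟨h1.resolve_right hL.ne', h2.resolve_right hH.ne'⟩

theorem isOpen_openRectangle (L H : ℝ) : IsOpen (openRectangle L H) := isOpen_Ioo.reProdIm isOpen_Ioo

theorem closure_openRectangle {L H : ℝ} (hL : 0 < L) (hH : 0 < H) :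
    closure (openRectangle L H) = Icc 0 L ×ℂ Icc 0 H := by
  rw [openRectangle, Complex.closure_reProdIm, closure_Ioo hL.ne, closure_Ioo hH.ne]

section

open scoped PeriodPair

variable {L H : ℝ} (hL : 0 < L) (hH : 0 < H)

local notation "Λ" => PeriodPair.lattice (rectanglePeriods L H hL hH)
local notation "W℘" => PeriodPair.weierstrassP (rectanglePeriods L H hL hH)
local notation "D℘" => PeriodPair.derivWeierstrassP (rectanglePeriods L H hL hH)

theorem mem_rectanglePeriods_lattice {z : ℂ} :
    z ∈ Λ ↔ ∃ m n : ℤ, z.re = 2 * L * m ∧ z.im = 2 * H * n := by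
  rw [PeriodPair.mem_lattice]
  refine exists_congr fun m => exists_congr fun n => ?_
  rw [Complex.ext_iff]
  simp only [rectanglePeriods]
  simp
  constructor <;> rintro ⟨h1, h2⟩ <;> constructor <;> linarith

theorem eq_zero_of_abs_lt_of_eq_mul_int {a b : ℝ} {m : ℤ} (ha : 0 < a) (h : b = a * m)
    (hb : |b| < a) : b = 0 := by
  rw [h, abs_mul, abs_of_pos ha] at hb
  have h1 : |(m : ℝ)| < 1 := by
    by_contra hc
    nlinarith [not_lt.1 hc]
  have h2 : m = 0 := Int.abs_lt_one_iff.1 (by exact_mod_cast h1)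
  rw [h, h2]; simp

theorem re_eq_zero_of_mem_lattice {z : ℂ} (hz : z ∈ Λ) (h : |z.re| < 2 * L) : z.re = 0 := by
  obtain ⟨m, n, h1, h2⟩ := (mem_rectanglePeriods_lattice hL hH).1 hz
  exact eq_zero_of_abs_lt_of_eq_mul_int (by linarith) h1 h

theorem im_eq_zero_of_mem_lattice {z : ℂ} (hz : z ∈ Λ) (h : |z.im| < 2 * H) : z.im = 0 := by
  obtain ⟨m, n, h1, h2⟩ := (mem_rectanglePeriods_lattice hL hH).1 hz
  exact eq_zero_of_abs_lt_of_eq_mul_int (by linarith) h2 h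

theorem two_mul_notMem_lattice_of_re {z : ℂ} (h0 : 0 < z.re) (h1 : z.re < L) : 2 * z ∉ Λ := by
  intro h
  have h2 := re_eq_zero_of_mem_lattice hL hH h
    (by simp only [Complex.mul_re]; simp; rw [abs_of_pos h0]; exact h1)
  simp at h2
  linarith

theorem notMem_lattice_of_re {z : ℂ} (h0 : 0 < z.re) (h1 : z.re < L) : z ∉ Λ := by
  intro h
  have h2 := re_eq_zero_of_mem_lattice hL hH h (by rw [abs_of_pos h0]; linarith)
  linarith

theorem notMem_lattice_of_im {z : ℂ} (h0 : z.im = H) : z ∉ Λ := by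
  intro h
  have h2 := im_eq_zero_of_mem_lattice hL hH h (by rw [h0, abs_of_pos hH]; linarith)
  linarith

theorem injOn_weierstrassP_openRectangle : InjOn W℘ (openRectangle L H) := by
  intro z hz w hw h
  by_contra hne
  obtain ⟨⟨z1, z2⟩, z3, z4⟩ := hz
  obtain ⟨⟨w1, w2⟩, w3, w4⟩ := hw
  refine PeriodPair.weierstrassP_ne _ (two_mul_notMem_lattice_of_re hL hH z1 z2)
    (two_mul_notMem_lattice_of_re hL hH w1 w2) ?_ ?_ h
  · intro hm
    have e1 := re_eq_zero_of_mem_lattice hL hH hm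
      (by rw [Complex.sub_re, abs_lt]; constructor <;> linarith)
    have e2 := im_eq_zero_of_mem_lattice hL hH hm
      (by rw [Complex.sub_im, abs_lt]; constructor <;> linarith)
    exact hne (Complex.ext (by simpa [sub_eq_zero] using e1) (by simpa [sub_eq_zero] using e2))
  · intro hm
    have e1 := re_eq_zero_of_mem_lattice hL hH hm
      (by rw [Complex.add_re, abs_lt]; constructor <;> linarith)
    rw [Complex.add_re] at e1
    linarith

open ComplexConjugate in
theorem weierstrassP_rectanglePeriods_conj (z : ℂ) : W℘ (conj z) = conj (W℘ z) := by
  refine PeriodPair.weierstrassP_conj _ (fun l hl => ?_) z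
  obtain ⟨m, n, h1, h2⟩ := (mem_rectanglePeriods_lattice hL hH).1 hl
  exact (mem_rectanglePeriods_lattice hL hH).2 ⟨m, -n, by simpa using h1, by simp [h2]⟩

/-- A real value would mean `℘(conj z) = ℘(z)`, but neither `conj z - z` nor `conj z + z` is a
period. -/
theorem im_weierstrassP_ne_zero {z : ℂ} (hz : z ∈ openRectangle L H) : (W℘ z).im ≠ 0 := by
  intro h
  have h1 := (weierstrassP_rectanglePeriods_conj hL hH z).trans (Complex.conj_eq_iff_im.2 h)
  obtain ⟨⟨z1, z2⟩, z3, z4⟩ := hz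
  refine PeriodPair.weierstrassP_ne _
    (two_mul_notMem_lattice_of_re hL hH (by simpa using z1) (by simpa using z2))
    (two_mul_notMem_lattice_of_re hL hH z1 z2) ?_ ?_ h1
  · intro hm
    have e1 := im_eq_zero_of_mem_lattice hL hH hm
      (by rw [Complex.sub_im, Complex.conj_im, abs_lt]; constructor <;> linarith)
    rw [Complex.sub_im, Complex.conj_im] at e1
    linarith
  · intro hm
    have e1 := re_eq_zero_of_mem_lattice hL hH hm
      (by rw [Complex.add_re, Complex.conj_re, abs_lt]; constructor <;> linarith)
    rw [Complex.add_re, Complex.conj_re] at e1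
    linarith

theorem im_weierstrassP_eq_zero_of_re {z : ℂ} (h : z.re = 0 ∨ z.re = L) : (W℘ z).im = 0 := by
  rw [← Complex.conj_eq_iff_im, ← weierstrassP_rectanglePeriods_conj,
    ← PeriodPair.weierstrassP_neg _ z]
  have hm : (⟨2 * z.re, 0⟩ : ℂ) ∈ Λ := by
    refine (mem_rectanglePeriods_lattice hL hH).2 ?_
    rcases h with h | h
    · exact ⟨0, 0, by simp [h], by simp⟩
    · exact ⟨1, 0, by simp [h], by simp⟩
  rw [← PeriodPair.weierstrassP_add _ hm (-z)]
  congr 1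
  apply Complex.ext <;> simp
  ring

theorem im_weierstrassP_eq_zero_of_im {z : ℂ} (h : z.im = 0 ∨ z.im = H) : (W℘ z).im = 0 := by
  rw [← Complex.conj_eq_iff_im, ← weierstrassP_rectanglePeriods_conj]
  have hm : (⟨0, 2 * z.im⟩ : ℂ) ∈ Λ := by
    refine (mem_rectanglePeriods_lattice hL hH).2 ?_
    rcases h with h | h
    · exact ⟨0, 0, by simp, by simp [h]⟩
    · exact ⟨0, 1, by simp, by simp [h]⟩
  rw [← PeriodPair.weierstrassP_add _ hm]
  congr 1
  apply Complex.ext <;> simp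
  ring

/-- The imaginary part of `℘` has no zero on the connected rectangle, so it has a constant sign;
which one is irrelevant for the energy. The image is open, and it is relatively closed in the
half-plane because `℘` is real on the sides and infinite at the corner `0`. Connectedness of the
half-plane gives surjectivity. -/
theorem exists_isConformalOntoHalfPlane_openRectangle :
    ∃ ε : ℝ, |ε| = 1 ∧ IsConformalOntoHalfPlane (openRectangle L H) (fun z => ε * W℘ z) := by
  have hcont : ContinuousOn (fun z => (W℘ z).im) (openRectangle L H) := fun z hz =>
    (Complex.continuous_im.continuousAt.comp (PeriodPair.differentiableAt_weierstrassP _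
      (notMem_lattice_of_re hL hH hz.1.1 hz.1.2)).continuousAt).continuousWithinAt
  have hconv : Convex ℝ (openRectangle L H) :=
    ((convex_Ioo 0 L).linear_preimage Complex.reLm).inter
      ((convex_Ioo 0 H).linear_preimage Complex.imLm)
  have hsign : ∃ ε : ℝ, |ε| = 1 ∧ ∀ z ∈ openRectangle L H, 0 < (ε * W℘ z).im := by
    by_cases hall : ∀ z ∈ openRectangle L H, 0 < (W℘ z).im
    · exact ⟨1, by simp, by simpa using hall⟩
    · refine ⟨-1, by simp, fun z hz => ?_⟩
      push Not at hall
      obtain ⟨w, hw, hw0⟩ := hall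
      by_contra hneg
      have hz0 : 0 ≤ (W℘ z).im := by simpa using hneg
      obtain ⟨u, hu, hu0⟩ := hconv.isPreconnected.intermediate_value hw hz hcont ⟨hw0, hz0⟩
      exact im_weierstrassP_ne_zero hL hH hu hu0
  obtain ⟨ε, hε, hpos⟩ := hsign
  have hε0 : ε ≠ 0 := by rintro rfl; simp at hε
  have hεC : (ε : ℂ) ≠ 0 := by exact_mod_cast hε0
  have hdiff : ∀ z ∈ openRectangle L H, AnalyticAt ℂ (fun z => ε * W℘ z) z := fun z hz =>
    analyticAt_const.mul (PeriodPair.analyticOnNhd_weierstrassP _ z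
      (notMem_lattice_of_re hL hH hz.1.1 hz.1.2))
  have hinj : InjOn (fun z => ε * W℘ z) (openRectangle L H) := fun z hz w hw h =>
    injOn_weierstrassP_openRectangle hL hH hz hw (mul_left_cancel₀ hεC h)
  refine ⟨ε, hε, fun z hz => (hdiff z hz).differentiableAt.differentiableWithinAt,
    fun z hz => hpos z hz, hinj, ?_⟩
  have hopen : IsOpen ((fun z => ε * W℘ z) '' openRectangle L H) := by
    rw [isOpen_iff_mem_nhds]
    rintro _ ⟨z, hz, rfl⟩
    have hnz := (isOpen_openRectangle L H).mem_nhds hz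
    rw [← (hdiff z hz).hasStrictDerivAt.map_nhds_eq ((hdiff z hz).deriv_ne_zero_of_injOn hnz hinj)]
    exact image_mem_map hnz
  have hhalf : Convex ℝ {z : ℂ | 0 < z.im} := convex_halfSpace_im_gt 0
  refine hhalf.isPreconnected.subset_of_closure_inter_subset hopen ?_ ?_
  · have hmid : (⟨L / 2, H / 2⟩ : ℂ) ∈ openRectangle L H :=
      ⟨⟨by simp; linarith, by simp; linarith⟩, by simp; linarith, by simp; linarith⟩
    exact ⟨_, hpos _ hmid, mem_image_of_mem _ hmid⟩
  · rintro w ⟨hw, hw0⟩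
    obtain ⟨x, hx, hxw⟩ := mem_closure_iff_seq_limit.1 hw
    choose u hu hux using hx
    have hK : IsCompact (Icc 0 L ×ℂ Icc 0 H) := isCompact_Icc.reProdIm isCompact_Icc
    obtain ⟨z, hz, σ, hσ, hlim⟩ := hK.tendsto_subseq (x := u) fun n =>
      closure_openRectangle hL hH ▸ subset_closure (hu n)
    obtain ⟨⟨z1, z2⟩, z3, z4⟩ := hz
    have hxw' : Tendsto (fun n => ε * W℘ (u (σ n))) atTop (𝓝 w) := by
      simpa [Function.comp_def, ← hux] using hxw.comp hσ.tendsto_atTop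
    by_cases hzΛ : z ∈ Λ
    · exfalso
      have hz0 : z = 0 := Complex.ext
        (re_eq_zero_of_mem_lattice hL hH hzΛ (by rw [abs_of_nonneg z1]; linarith))
        (im_eq_zero_of_mem_lattice hL hH hzΛ (by rw [abs_of_nonneg z3]; linarith))
      have h1 : Tendsto (u ∘ σ) atTop (𝓝[≠] 0) := by
        refine tendsto_nhdsWithin_iff.2 ⟨hz0 ▸ hlim, Eventually.of_forall fun n hn => ?_⟩
        have := (hu (σ n)).1.1
        have hn' : u (σ n) = 0 := hn
        rw [hn'] at this
        simp at this
      have h2 := (PeriodPair.tendsto_weierstrassP_cobounded (rectanglePeriods L H hL hH)).comp h1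
      have h3 : Tendsto (fun n => W℘ (u (σ n))) atTop (𝓝 ((ε : ℂ)⁻¹ * w)) := by
        refine (hxw'.const_mul (ε : ℂ)⁻¹).congr fun n => ?_
        rw [inv_mul_cancel_left₀ hεC]
      exact h3.not_tendsto (Metric.disjoint_nhds_cobounded _) h2
    · have hc : ContinuousAt (fun z => ε * W℘ z) z := continuousAt_const.mul
        (PeriodPair.differentiableAt_weierstrassP _ hzΛ).continuousAt
      have hwz := tendsto_nhds_unique hxw' (hc.tendsto.comp hlim)
      have him : (W℘ z).im ≠ 0 := by
        intro h
        have hw0' : 0 < w.im := hw0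
        rw [hwz] at hw0'
        simp [h] at hw0'
      refine ⟨z, ⟨⟨lt_of_le_of_ne z1 ?_, lt_of_le_of_ne z2 ?_⟩, lt_of_le_of_ne z3 ?_,
        lt_of_le_of_ne z4 ?_⟩, hwz.symm⟩
      · exact fun h => him (im_weierstrassP_eq_zero_of_re hL hH (.inl h.symm))
      · exact fun h => him (im_weierstrassP_eq_zero_of_re hL hH (.inr h))
      · exact fun h => him (im_weierstrassP_eq_zero_of_im hL hH (.inl h.symm))
      · exact fun h => him (im_weierstrassP_eq_zero_of_im hL hH (.inr h))

/-- On the closed rectangle the condition `2 * p ∉ Λ` excludes exactly the four corners. -/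
theorem hasRegularBoundaryValue_mul_weierstrassP {Ω : Set ℂ} {ε : ℝ} (hε : |ε| = 1) {p : ℂ}
    (hp : 2 * p ∉ Λ) :
    HasRegularBoundaryValue Ω (fun z => ε * W℘ z) p (ε * W℘ p) (ε * D℘ p) := by
  have hp' : p ∉ Λ := fun h => hp (by rw [two_mul]; exact add_mem h h)
  have hε0 : (ε : ℂ) ≠ 0 := by
    intro h
    rw [Complex.ofReal_eq_zero.1 h] at hε
    simp at hε
  refine ⟨?_, ?_, mul_ne_zero hε0 (PeriodPair.derivWeierstrassP_ne_zero _ hp)⟩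
  · exact ((PeriodPair.differentiableAt_weierstrassP _ hp').continuousAt.tendsto.const_mul
      _).mono_left nhdsWithin_le_nhds
  · have : deriv (fun z => ε * W℘ z) = fun z => ε * D℘ z := by
      ext z
      rw [deriv_const_mul_field, PeriodPair.deriv_weierstrassP]
    rw [this]
    exact ((PeriodPair.differentiableAt_derivWeierstrassP _ hp').continuousAt.tendsto.const_mul
      _).mono_left nhdsWithin_le_nhds

/-- The energy of two points on opposite sides of a rectangle. -/
theorem renormalizedEnergy_openRectangle {x y : ℝ} (hx : x ∈ Ioo 0 L) (hy : y ∈ Ioo 0 L) :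
    renormalizedEnergy (openRectangle L H) ⟨x, 0⟩ ⟨y, H⟩ =
      -(2 / Real.pi * Real.log |(W℘ ⟨y - x, H⟩).re - (W℘ ⟨x + y, H⟩).re|) := by
  set p : ℂ := ⟨x, 0⟩ with hp
  set q : ℂ := ⟨y, H⟩ with hq
  obtain ⟨ε, hε, hconf⟩ := exists_isConformalOntoHalfPlane_openRectangle hL hH
  have hp2 : 2 * p ∉ Λ := two_mul_notMem_lattice_of_re hL hH hx.1 hx.2
  have hq2 : 2 * q ∉ Λ := two_mul_notMem_lattice_of_re hL hH hy.1 hy.2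
  have hmulΛ : ∀ {z : ℂ}, 2 * z ∉ Λ → z ∉ Λ := fun h h' => h (by rw [two_mul]; exact add_mem h' h')
  have hval : IsRenormalizedEnergyValue (openRectangle L H) p q
      (2 / Real.pi * Real.log (‖ε * W℘ p - ε * W℘ q‖ ^ 2 / (‖ε * D℘ p‖ * ‖ε * D℘ q‖))) :=
    ⟨_, _, _, _, _, hconf, hasRegularBoundaryValue_mul_weierstrassP hL hH hε hp2,
      hasRegularBoundaryValue_mul_weierstrassP hL hH hε hq2, rfl⟩
  have hpc : p ∈ closure (openRectangle L H) := by
    rw [closure_openRectangle hL hH]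
    exact ⟨⟨hx.1.le, hx.2.le⟩, le_rfl, hH.le⟩
  have hqc : q ∈ closure (openRectangle L H) := by
    rw [closure_openRectangle hL hH]
    exact ⟨⟨hy.1.le, hy.2.le⟩, hH.le, le_rfl⟩
  have hex : ∃ w, IsRenormalizedEnergyValue (openRectangle L H) p q w := ⟨_, hval⟩
  rw [renormalizedEnergy, dif_pos hex,
    hex.choose_spec.unique (isOpen_openRectangle L H) hpc hqc hval, ← mul_neg, ← Real.log_inv]
  congr 2
  have hsub : q - p = ⟨y - x, H⟩ := by apply Complex.ext <;> simp [hp, hq]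
  have hadd : q + p = ⟨x + y, H⟩ := by apply Complex.ext <;> simp [hp, hq, add_comm]
  -- The product formula at `q` and `p`: dividing by it leaves only `℘(q - p) - ℘(q + p)`, and both
  -- values are real on the line `im = H`.
  have hid := PeriodPair.derivWeierstrassP_mul _ (hmulΛ hp2)
    (PeriodPair.derivWeierstrassP_ne_zero _ hp2) (hmulΛ hq2)
    (notMem_lattice_of_im hL hH (by simp [hp, hq])) (notMem_lattice_of_im hL hH (by simp [hp, hq]))
  rw [hsub, hadd] at hid
  have hre : ∀ u : ℝ, W℘ ⟨u, H⟩ = ((W℘ ⟨u, H⟩).re : ℂ) := fun u =>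
    Complex.ext rfl (im_weierstrassP_eq_zero_of_im hL hH (.inr rfl))
  rw [hre (y - x), hre (x + y), ← Complex.ofReal_sub] at hid
  have hne : W℘ q - W℘ p ≠ 0 := by
    refine sub_ne_zero.2 (PeriodPair.weierstrassP_ne _ hq2 hp2 ?_ ?_)
    · exact notMem_lattice_of_im hL hH (by simp [hp, hq])
    · exact notMem_lattice_of_im hL hH (by simp [hp, hq])
  have hnorm := congrArg norm hid
  rw [norm_mul, norm_mul, norm_pow, Complex.norm_real, Real.norm_eq_abs] at hnorm
  have hne' : ‖W℘ q - W℘ p‖ ≠ 0 := norm_ne_zero_iff.2 hne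
  rw [← mul_sub, norm_mul, norm_mul, norm_mul, Complex.norm_real, Real.norm_eq_abs, hε, one_mul,
    one_mul, one_mul, mul_comm ‖D℘ p‖, hnorm, norm_sub_rev (W℘ p)]
  rw [div_mul_eq_div_div, div_self (pow_ne_zero 2 hne'), one_div]

/-! ### Symmetry and monotonicity of `℘` along the line `im = H`. -/

theorem weierstrassP_top_neg (u : ℝ) : W℘ ⟨-u, H⟩ = W℘ ⟨u, H⟩ := by
  have hm : (⟨0, 2 * H⟩ : ℂ) ∈ Λ :=
    (mem_rectanglePeriods_lattice hL hH).2 ⟨0, 1, by simp, by simp⟩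
  rw [← PeriodPair.weierstrassP_neg _ ⟨u, H⟩, ← PeriodPair.weierstrassP_add _ hm (-⟨u, H⟩)]
  congr 1
  apply Complex.ext <;> simp
  ring

theorem weierstrassP_top_reflect (u : ℝ) : W℘ ⟨2 * L - u, H⟩ = W℘ ⟨u, H⟩ := by
  have hm : (⟨2 * L, 0⟩ : ℂ) ∈ Λ :=
    (mem_rectanglePeriods_lattice hL hH).2 ⟨1, 0, by simp, by simp⟩
  rw [← weierstrassP_top_neg hL hH u, ← PeriodPair.weierstrassP_add _ hm ⟨-u, H⟩]
  congr 1
  apply Complex.ext <;> simp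
  ring

/-- The derivative of this real function is `℘'`, which is real on the line and has no zero over
`(0, L)`; hence it keeps one sign. -/
theorem strictMonoOn_or_strictAntiOn_weierstrassP_top :
    StrictMonoOn (fun u : ℝ => (W℘ ⟨u, H⟩).re) (Icc 0 L) ∨
      StrictAntiOn (fun u : ℝ => (W℘ ⟨u, H⟩).re) (Icc 0 L) := by
  have hmk : ∀ u : ℝ, (⟨u, H⟩ : ℂ) = u + H * Complex.I := fun u => by
    apply Complex.ext <;> simp
  have hC : ∀ u : ℝ, HasDerivAt (fun z : ℂ => W℘ (z + H * Complex.I)) (D℘ ⟨u, H⟩) (u : ℂ) := by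
    intro u
    have h := PeriodPair.hasDerivAt_weierstrassP (rectanglePeriods L H hL hH) (z := ⟨u, H⟩)
      (notMem_lattice_of_im hL hH rfl)
    rw [hmk u] at h ⊢
    exact h.comp_add_const _ _
  have hR : ∀ u : ℝ, HasDerivAt (fun u : ℝ => (W℘ ⟨u, H⟩).re) (D℘ ⟨u, H⟩).re u := by
    intro u
    simpa only [← hmk] using (hC u).real_of_complex
  have hreal : ∀ u : ℝ, D℘ ⟨u, H⟩ = ((D℘ ⟨u, H⟩).re : ℂ) := by
    intro u
    have h1 := (hR u).ofReal_comp
    have h2 := (hC u).comp_ofReal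
    refine h2.unique (h1.congr_of_eventuallyEq (Eventually.of_forall fun v => ?_))
    simp only [← hmk]
    exact Complex.ext rfl (im_weierstrassP_eq_zero_of_im hL hH (.inr rfl))
  have hne : ∀ u ∈ Ioo 0 L, (D℘ ⟨u, H⟩).re ≠ 0 := by
    intro u hu h
    apply PeriodPair.derivWeierstrassP_ne_zero _ (two_mul_notMem_lattice_of_re hL hH
      (z := ⟨u, H⟩) hu.1 hu.2)
    rw [hreal, h, Complex.ofReal_zero]
  have hcont : ContinuousOn (fun u : ℝ => (W℘ ⟨u, H⟩).re) (Icc 0 L) := fun u _ =>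
    (hR u).continuousAt.continuousWithinAt
  rcases hasDerivWithinAt_forall_lt_or_forall_gt_of_forall_ne (convex_Ioo 0 L)
    (fun u _ => (hR u).hasDerivWithinAt) hne with h | h
  · right
    refine strictAntiOn_of_deriv_neg (convex_Icc 0 L) hcont fun u hu => ?_
    rw [interior_Icc] at hu
    rw [(hR u).deriv]
    exact h u hu
  · left
    refine strictMonoOn_of_deriv_pos (convex_Icc 0 L) hcont fun u hu => ?_
    rw [interior_Icc] at hu
    rw [(hR u).deriv]
    exact h u hu

end

/-! ### Descent of the energy towards the midpoints. -/

/-- If `q` is even, symmetric about `L` and strictly increasing on `[0, L]`, then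
`|q (y - x) - q (x + y)|` increases when `(x, y)` moves towards `(L / 2, L / 2)`. -/
theorem abs_sub_lt_abs_sub_of_towards_center {q : ℝ → ℝ} {L x y r : ℝ}
    (hmono : StrictMonoOn q (Icc 0 L)) (heven : ∀ u, q (-u) = q u)
    (hrefl : ∀ u, q (2 * L - u) = q u) (hx : x ∈ Ioo (L / 4) (3 * L / 4))
    (hy : y ∈ Ioo (L / 4) (3 * L / 4)) (hr0 : 0 ≤ r) (hr1 : r < 1)
    (hne : ¬(x = L / 2 ∧ y = L / 2)) :
    0 < |q (y - x) - q (x + y)| ∧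
      |q (y - x) - q (x + y)| <
        |q ((L / 2 + r * (y - L / 2)) - (L / 2 + r * (x - L / 2))) -
          q ((L / 2 + r * (x - L / 2)) + (L / 2 + r * (y - L / 2)))| := by
  obtain ⟨x1, x2⟩ := hx
  obtain ⟨y1, y2⟩ := hy
  have hqa : ∀ u, q |u| = q u := fun u => by
    rcases abs_choice u with h | h <;> rw [h]
    exact heven u
  have hqL : ∀ u, q (L - |u|) = q (L + u) := fun u => by
    rcases abs_choice u with h | h <;> rw [h]
    · rw [← hrefl]; congr 1; ring
    · congr 1; ring
  -- In these coordinates the two terms are `q |d|` and `q (L - |e|)`, and the contraction by `r`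
  -- multiplies both `d` and `e` by `r`. The bounds on `x`, `y` give `|d|, |e| < L / 2`, hence `|d|
  -- < L - |e|`.
  set d := y - x with hd
  set e := x + y - L with he
  have hd' : |d| < L / 2 := by rw [abs_lt]; constructor <;> linarith
  have he' : |e| < L / 2 := by rw [abs_lt]; constructor <;> linarith
  have h1 : (L / 2 + r * (y - L / 2)) - (L / 2 + r * (x - L / 2)) = r * d := by ring
  have h2 : (L / 2 + r * (x - L / 2)) + (L / 2 + r * (y - L / 2)) = L + r * e := by ring
  have h3 : x + y = L + e := by ring
  rw [h1, h2, h3, ← hqa d, ← hqL e, ← hqa (r * d), ← hqL (r * e), abs_mul, abs_mul,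
    abs_of_nonneg hr0]
  have d0 := abs_nonneg d
  have e0 := abs_nonneg e
  have rd : r * |d| ≤ |d| := mul_le_of_le_one_left d0 hr1.le
  have re : r * |e| ≤ |e| := mul_le_of_le_one_left e0 hr1.le
  have rd0 : 0 ≤ r * |d| := mul_nonneg hr0 d0
  have re0 : 0 ≤ r * |e| := mul_nonneg hr0 e0
  have m1 : q |d| < q (L - |e|) :=
    hmono ⟨d0, by linarith⟩ ⟨by linarith, by linarith⟩ (by linarith)
  have m2 : q (r * |d|) ≤ q |d| := hmono.monotoneOn ⟨rd0, by linarith⟩ ⟨d0, by linarith⟩ rd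
  have m3 : q (L - |e|) ≤ q (L - r * |e|) :=
    hmono.monotoneOn ⟨by linarith, by linarith⟩ ⟨by linarith, by linarith⟩ (by linarith)
  rw [abs_sub_comm (q |d|), abs_sub_comm (q (r * |d|)), abs_of_pos (sub_pos.2 m1),
    abs_of_pos (show 0 < q (L - r * |e|) - q (r * |d|) by linarith)]
  refine ⟨sub_pos.2 m1, ?_⟩
  by_cases hd0 : d = 0
  · have he0 : 0 < |e| := by
      rw [abs_pos]
      intro h
      exact hne ⟨by linarith, by linarith⟩
    have m4 : q (L - |e|) < q (L - r * |e|) :=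
      hmono ⟨by linarith, by linarith⟩ ⟨by linarith, by linarith⟩ (by nlinarith)
    linarith
  · have hd0 : 0 < |d| := abs_pos.2 hd0
    have m4 : q (r * |d|) < q |d| := hmono ⟨rd0, by linarith⟩ ⟨d0, by linarith⟩ (by nlinarith)
    linarith

/-- The energy of two points on opposite sides decreases along segments towards the midpoints. -/
theorem renormalizedEnergy_openRectangle_lt {L H x y r : ℝ} (hL : 0 < L) (hH : 0 < H)
    (hx : x ∈ Ioo (L / 4) (3 * L / 4)) (hy : y ∈ Ioo (L / 4) (3 * L / 4)) (hr0 : 0 ≤ r)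
    (hr1 : r < 1) (hne : ¬(x = L / 2 ∧ y = L / 2)) :
    renormalizedEnergy (openRectangle L H) ⟨L / 2 + r * (x - L / 2), 0⟩
        ⟨L / 2 + r * (y - L / 2), H⟩ <
      renormalizedEnergy (openRectangle L H) ⟨x, 0⟩ ⟨y, H⟩ := by
  have hmem : ∀ {x}, x ∈ Ioo (L / 4) (3 * L / 4) → x ∈ Ioo 0 L ∧
      L / 2 + r * (x - L / 2) ∈ Ioo 0 L := by
    rintro x ⟨x1, x2⟩
    refine ⟨⟨by linarith, by linarith⟩, ?_, ?_⟩
    · nlinarith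
    · nlinarith
  rw [renormalizedEnergy_openRectangle hL hH (hmem hx).1 (hmem hy).1,
    renormalizedEnergy_openRectangle hL hH (hmem hx).2 (hmem hy).2]
  -- The sign `s = ±1` reduces the decreasing case to the increasing one; absolute values do not see
  -- it.
  have hkey : ∀ s : ℝ, StrictMonoOn (fun u : ℝ =>
      s * ((rectanglePeriods L H hL hH).weierstrassP ⟨u, H⟩).re) (Icc 0 L) → |s| = 1 →
      0 < |((rectanglePeriods L H hL hH).weierstrassP ⟨y - x, H⟩).re -
          ((rectanglePeriods L H hL hH).weierstrassP ⟨x + y, H⟩).re| ∧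
        |((rectanglePeriods L H hL hH).weierstrassP ⟨y - x, H⟩).re -
          ((rectanglePeriods L H hL hH).weierstrassP ⟨x + y, H⟩).re| <
        |((rectanglePeriods L H hL hH).weierstrassP
            ⟨(L / 2 + r * (y - L / 2)) - (L / 2 + r * (x - L / 2)), H⟩).re -
          ((rectanglePeriods L H hL hH).weierstrassP
            ⟨(L / 2 + r * (x - L / 2)) + (L / 2 + r * (y - L / 2)), H⟩).re| := by
    intro s hs hs1
    have h := abs_sub_lt_abs_sub_of_towards_center hs
      (fun u => by simp only [weierstrassP_top_neg])
      (fun u => by simp only [weierstrassP_top_reflect]) hx hy hr0 hr1 hne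
    simpa only [← mul_sub, abs_mul, hs1, one_mul] using h
  obtain ⟨hpos, hlt⟩ := (strictMonoOn_or_strictAntiOn_weierstrassP_top hL hH).elim
    (fun h => hkey 1 (by simpa using h) (by simp))
    (fun h => hkey (-1) (by simpa using h.neg) (by simp))
  have hπ : 0 < 2 / Real.pi := by positivity
  exact neg_lt_neg (mul_lt_mul_of_pos_left (Real.log_lt_log hpos hlt) hπ)

/-! ### Boundary pairs near the midpoints, and the conclusion. -/

theorem mk_mem_frontier_openRectangle {L H x t : ℝ} (hL : 0 < L) (hH : 0 < H)
    (hx : x ∈ Ioo 0 L) (ht : t = 0 ∨ t = H) : (⟨x, t⟩ : ℂ) ∈ frontier (openRectangle L H) := by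
  rw [(isOpen_openRectangle L H).frontier_eq, closure_openRectangle hL hH]
  refine ⟨⟨⟨hx.1.le, hx.2.le⟩, ?_⟩, fun h => ?_⟩
  · rcases ht with rfl | rfl
    · exact ⟨le_rfl, hH.le⟩
    · exact ⟨hH.le, le_rfl⟩
  · have h1 : 0 < t := h.2.1
    have h2 : t < H := h.2.2
    rcases ht with rfl | rfl <;> linarith

theorem im_of_mem_frontier_openRectangle {L H : ℝ} {z : ℂ} (hL : 0 < L) (hH : 0 < H)
    (hz : z ∈ frontier (openRectangle L H)) (hre : z.re ∈ Ioo 0 L) : z.im = 0 ∨ z.im = H := by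
  rw [(isOpen_openRectangle L H).frontier_eq, closure_openRectangle hL hH] at hz
  obtain ⟨⟨_, h1, h2⟩, h3⟩ := hz
  by_contra! h
  exact h3 ⟨hre, lt_of_le_of_ne h1 (Ne.symm h.1), lt_of_le_of_ne h2 h.2⟩

theorem theorem7p1 (L H : ℝ) (hL : 0 < L) (hLH : L ≤ H) :
    IsIsolatedLocalMinOn
      (fun z : ℂ × ℂ => renormalizedEnergy (openRectangle L H) z.1 z.2)
      (distinctBoundaryPairs (openRectangle L H))
      ((⟨L / 2, 0⟩ : ℂ), (⟨L / 2, H⟩ : ℂ)) := by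
  have hH : 0 < H := hL.trans_le hLH
  have hsub : ∀ {x}, x ∈ Ioo (L / 4) (3 * L / 4) → x ∈ Ioo 0 L := fun h =>
    ⟨by linarith [h.1], by linarith [h.2]⟩
  have hmem : ∀ {x y}, x ∈ Ioo 0 L → y ∈ Ioo 0 L →
      ((⟨x, 0⟩ : ℂ), (⟨y, H⟩ : ℂ)) ∈ distinctBoundaryPairs (openRectangle L H) := by
    intro x y hx hy
    refine ⟨mk_mem_frontier_openRectangle hL hH hx (.inl rfl),
      mk_mem_frontier_openRectangle hL hH hy (.inr rfl), fun h => ?_⟩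
    have h' : (0 : ℝ) = H := congrArg Complex.im h
    linarith
  have hmid : L / 2 ∈ Ioo (L / 4) (3 * L / 4) := ⟨by linarith, by linarith⟩
  have hnear : ∀ᶠ z : ℂ × ℂ in 𝓝 ((⟨L / 2, 0⟩ : ℂ), (⟨L / 2, H⟩ : ℂ)),
      z ∈ distinctBoundaryPairs (openRectangle L H) →
      ∃ x ∈ Ioo (L / 4) (3 * L / 4), ∃ y ∈ Ioo (L / 4) (3 * L / 4), z = (⟨x, 0⟩, ⟨y, H⟩) := by
    have c1 : Continuous fun z : ℂ × ℂ => z.1.re := Complex.continuous_re.comp continuous_fst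
    have c2 : Continuous fun z : ℂ × ℂ => z.1.im := Complex.continuous_im.comp continuous_fst
    have c3 : Continuous fun z : ℂ × ℂ => z.2.re := Complex.continuous_re.comp continuous_snd
    have c4 : Continuous fun z : ℂ × ℂ => z.2.im := Complex.continuous_im.comp continuous_snd
    filter_upwards [c1.continuousAt.eventually_mem (Ioo_mem_nhds hmid.1 hmid.2),
      c3.continuousAt.eventually_mem (Ioo_mem_nhds hmid.1 hmid.2),
      c2.continuousAt.eventually_lt continuousAt_const hH,
      continuousAt_const.eventually_lt c4.continuousAt hH] with z h1 h2 h3 h4 hz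
    refine ⟨z.1.re, h1, z.2.re, h2, ?_⟩
    have e1 := (im_of_mem_frontier_openRectangle hL hH hz.1 (hsub h1)).resolve_right h3.ne
    have e2 := (im_of_mem_frontier_openRectangle hL hH hz.2.1 (hsub h2)).resolve_left h4.ne'
    exact Prod.ext (Complex.ext rfl e1) (Complex.ext rfl e2)
  have hstrict : ∀ {x y}, x ∈ Ioo (L / 4) (3 * L / 4) → y ∈ Ioo (L / 4) (3 * L / 4) →
      ¬(x = L / 2 ∧ y = L / 2) →
      renormalizedEnergy (openRectangle L H) ⟨L / 2, 0⟩ ⟨L / 2, H⟩ <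
        renormalizedEnergy (openRectangle L H) ⟨x, 0⟩ ⟨y, H⟩ := by
    intro x y hx hy hne
    -- The factor `r = 0` contracts all the way to the midpoints.
    simpa using renormalizedEnergy_openRectangle_lt hL hH hx hy le_rfl zero_lt_one hne
  refine ⟨hmem (hsub hmid) (hsub hmid), ?_, ?_, ?_⟩
  · refine eventually_nhdsWithin_iff.2 (hnear.mono fun z hz hzS => ?_)
    obtain ⟨x, hx, y, hy, rfl⟩ := hz hzS
    by_cases hne : x = L / 2 ∧ y = L / 2
    · rw [hne.1, hne.2]
    · exact (hstrict hx hy hne).le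
  · refine eventually_nhdsWithin_iff.2 (hnear.mono fun z hz hzS => ?_)
    obtain ⟨x, hx, y, hy, rfl⟩ := hz hzS.1
    exact hstrict hx hy fun hne => hzS.2 (by rw [hne.1, hne.2]; rfl)
  · refine eventually_nhdsWithin_iff.2 (hnear.mono fun z hz hzS hmin => ?_)
    obtain ⟨x, hx, y, hy, rfl⟩ := hz hzS.1
    have hne : ¬(x = L / 2 ∧ y = L / 2) := fun hne => hzS.2 (by rw [hne.1, hne.2]; rfl)
    -- As `r → 1` from below, `γ r` tends to the given pair through boundary pairs of strictly
    -- smaller energy, so that pair is not a local minimizer.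
    set γ : ℝ → ℂ × ℂ := fun r =>
      (⟨L / 2 + r * (x - L / 2), 0⟩, ⟨L / 2 + r * (y - L / 2), H⟩) with hγ
    have hγc : Continuous γ := by
      have h1 : ∀ x t : ℝ, Continuous fun r : ℝ => (⟨L / 2 + r * (x - L / 2), t⟩ : ℂ) := by
        intro x t
        have : (fun r : ℝ => (⟨L / 2 + r * (x - L / 2), t⟩ : ℂ)) = fun r : ℝ =>
            ((L / 2 + r * (x - L / 2) : ℝ) : ℂ) + t * Complex.I := by
          ext r
          apply Complex.ext <;> simp
        rw [this]
        fun_prop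
      exact (h1 x 0).prodMk (h1 y H)
    have hγ1 : γ 1 = (⟨x, 0⟩, ⟨y, H⟩) := by simp [hγ]
    have hr : ∀ᶠ r : ℝ in 𝓝[<] 1, r ∈ Ioo (0 : ℝ) 1 := Ioo_mem_nhdsLT zero_lt_one
    have hlim : Tendsto γ (𝓝[<] 1) (𝓝[distinctBoundaryPairs (openRectangle L H)]
        (⟨x, 0⟩, ⟨y, H⟩)) := by
      refine tendsto_nhdsWithin_iff.2 ⟨?_, ?_⟩
      · rw [← hγ1]
        exact (hγc.tendsto 1).mono_left nhdsWithin_le_nhds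
      · filter_upwards [hr] with r hr
        obtain ⟨r0, r1⟩ := hr
        obtain ⟨x1, x2⟩ := hx
        obtain ⟨y1, y2⟩ := hy
        exact hmem ⟨by nlinarith, by nlinarith⟩ ⟨by nlinarith, by nlinarith⟩
    obtain ⟨r, hle, hr⟩ := ((hlim.eventually hmin).and hr).exists
    exact (renormalizedEnergy_openRectangle_lt hL hH hx hy hr.1.le hr.2 hne).not_ge hle
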